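/- A flat clustered graph $G=(V,E,\mathcal C)$ is a finite simple graph $(V,E)$ with a partition $\mathcal C=\{V_1,\dots,V_k\}$ of $V$ into non-empty clusters; an edge between different clusters $V_i,V_j$ is an inter-cluster edge, and it is incident to $V_i$ and to $V_j$. An instance of Monotone NodeTrix Local Planarity with Fixed Order and Fixed Side consists of a flat clustered graph $G$ together with, for every cluster $V_i$: an axis-aligned closed square $Q_i=\gamma(V_i)$ in the plane with rational coordinates and positive side length; a row-column order, i.e. a bijection $\sigma_i:V_i\to\{1,\dots,|V_i|\}$; and a map $s_i$ that assigns to every inter-cluster edge incident to $V_i$ one of the four sides (top, bottom, left, right) of $Q_i$. Divide each side of $Q_i$ into $|V_i|$ equal segments, numbered from left to right on the top and the bottom side and from top to bottom on the left and the right side. The incidence point of an inter-cluster edge $e$ at its end-vertex $u\in V_i$ is the mid-point of the $\sigma_i(u)$-th segment of the side $s_i(e)$ of $Q_i$. The question is whether the squares $Q_1,\dots,Q_k$ are pairwise disjoint and every inter-cluster edge $e$ can be drawn as a simple arc $\Gamma_e$ between its two incidence points so that: (1) every $\Gamma_e$ is $xy$-monotone, i.e. it is a horizontal or vertical segment, or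 no two of its points have the same $x$-coordinate and no two have the same $y$-coordinate; (2) whenever there is an edge between $V_i$ and $V_j$, $i\ne j$, the convex hull of $Q_i\cup Q_j$ is disjoint from every $Q_h$ with $h\neq i,j$, and $\Gamma_e$ lies in this convex hull for every edge $e$ between $V_i$ and $V_j$; (3) no $\Gamma_e$ meets a square $Q_h$ except at the incidence points of $e$; and (4) no two distinct inter-cluster edges incident to a common cluster cross, i.e. $\Gamma_e$ and $\Gamma_f$ have no common point other than a common end-point. Theorem. This decision problem can be solved in polynomial time, i.e. in time polynomial in the number of bits of the instance. -/

import Mathlib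

/-! ### Random access machine with logarithmic cost -/

namespace RAM

/-- A machine state: finitely many registers are used by a program, and there is a random access
memory of integer cells. -/
structure State where
  reg : ℕ → ℤ
  mem : ℤ → ℤ

/-- Number of bits that are charged for an integer (binary length of `|z|`, plus one for the
sign). -/
def bits (z : ℤ) : ℕ := Nat.size z.natAbs + 1

/-- Arithmetic expressions: constants, registers, indirect memory access, `+`, `-`, `*`. -/
inductive Expr where
  | const (z : ℤ)
  | reg (r : ℕ)
  | load (a : Expr)
  | add (a b : Expr)
  | sub (a b : Expr)
  | mul (a b : Expr)

/-- The value of an expression in a state. -/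
def Expr.eval (s : State) : Expr → ℤ
  | .const z => z
  | .reg r => s.reg r
  | .load a => s.mem (a.eval s)
  | .add a b => a.eval s + b.eval s
  | .sub a b => a.eval s - b.eval s
  | .mul a b => a.eval s * b.eval s

/-- The logarithmic cost of evaluating an expression: every operation is charged the number of bits
of its operands (through their own costs) and of its result. -/
def Expr.cost (s : State) : Expr → ℕ
  | .const z => bits z
  | .reg r => bits (s.reg r)
  | .load a => a.cost s + bits (s.mem (a.eval s))
  | .add a b => a.cost s + b.cost s + bits (a.eval s + b.eval s)
  | .sub a b => a.cost s + b.cost s + bits (a.eval s - b.eval s)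
  | .mul a b => a.cost s + b.cost s + bits (a.eval s * b.eval s)

/-- Programs. Tests are of the form `0 < e`. -/
inductive Prog where
  | skip
  | assign (r : ℕ) (e : Expr)
  | store (a e : Expr)
  | seq (p q : Prog)
  | ite (e : Expr) (p q : Prog)
  | loop (e : Expr) (p : Prog)

/-- Writing a register. -/
def State.setReg (s : State) (r : ℕ) (z : ℤ) : State :=
  { s with reg := Function.update s.reg r z }

/-- Writing a memory cell. -/
def State.setMem (s : State) (a z : ℤ) : State :=
  { s with mem := Function.update s.mem a z }

/-- `Exec p s t s'`: the program `p`, started in the state `s`, halts in the state `s'` after a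
computation of total cost `t`. Exactly one rule applies to each program and state. -/
inductive Exec : Prog → State → ℕ → State → Prop where
  | skip (s : State) : Exec .skip s 1 s
  | assign (r : ℕ) (e : Expr) (s : State) :
      Exec (.assign r e) s (e.cost s + 1) (s.setReg r (e.eval s))
  | store (a e : Expr) (s : State) :
      Exec (.store a e) s (a.cost s + e.cost s + 1) (s.setMem (a.eval s) (e.eval s))
  | seq {p q : Prog} {s s₁ s₂ : State} {t₁ t₂ : ℕ} :
      Exec p s t₁ s₁ → Exec q s₁ t₂ s₂ → Exec (.seq p q) s (t₁ + t₂) s₂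
  | ite_pos {e : Expr} {p q : Prog} {s s₁ : State} {t : ℕ} :
      0 < e.eval s → Exec p s t s₁ → Exec (.ite e p q) s (e.cost s + 1 + t) s₁
  | ite_neg {e : Expr} {p q : Prog} {s s₁ : State} {t : ℕ} :
      ¬ 0 < e.eval s → Exec q s t s₁ → Exec (.ite e p q) s (e.cost s + 1 + t) s₁
  | loop_pos {e : Expr} {p : Prog} {s s₁ s₂ : State} {t₁ t₂ : ℕ} :
      0 < e.eval s → Exec p s t₁ s₁ → Exec (.loop e p) s₁ t₂ s₂ →
        Exec (.loop e p) s (e.cost s + 1 + t₁ + t₂) s₂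
  | loop_neg {e : Expr} {p : Prog} {s : State} :
      ¬ 0 < e.eval s → Exec (.loop e p) s (e.cost s + 1) s

/-- The initial state: the input stands in the cells `0, 1, 2, …`, everything else is `0`. -/
def init (input : List ℤ) : State where
  reg := fun _ => 0
  mem := fun i => if 0 ≤ i then input.getD i.toNat 0 else 0

/-- The size of an input, in bits. -/
def inputSize (input : List ℤ) : ℕ := (input.map bits).sum

open Classical in
/-- The decision problem `P`, with instances presented through `enc`, is solvable in polynomial
time: one program halts on every instance within a cost polynomial in the number of bits of the
instance, and leaves in register `0` the value `1` on the instances with `P` and `0` on the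
others. -/
def SolvableInPolyTime {α : Type*} (enc : α → List ℤ) (P : α → Prop) : Prop :=
  ∃ (p : Prog) (T : Polynomial ℕ), ∀ a : α, ∃ (t : ℕ) (s : State),
    Exec p (init (enc a)) t s ∧ t ≤ T.eval (inputSize (enc a)) ∧
      s.reg 0 = if P a then 1 else 0

end RAM

/-! ### NodeTrix representations -/

namespace NodeTrix

/-- A flat clustered graph: a graph with a partition of its vertices into (non-empty) clusters,
which are indexed by `C`. -/
structure ClusteredGraph (V C : Type*) where
  graph : SimpleGraph V
  cluster : V → C
  cluster_surjective : Function.Surjective cluster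

/-- The four sides of a matrix. -/
inductive Side where
  | top
  | bottom
  | left
  | right

/-- An axis-aligned square, given by its lower left corner and the length of its sides. -/
structure Square where
  x : ℝ
  y : ℝ
  len : ℝ
  len_pos : 0 < len

/-- The closed region covered by a square. -/
def Square.region (Q : Square) : Set (ℝ × ℝ) :=
  Set.Icc Q.x (Q.x + Q.len) ×ˢ Set.Icc Q.y (Q.y + Q.len)

/-- In an `n × n` matrix with boundary `Q`, the mid-point of the intersection of the `j`-th column
(`1 ≤ j ≤ n`, from left to right) with the top or the bottom side of `Q`, and of the `j`-th row
(from top to bottom) with the left or the right side of `Q`. -/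
noncomputable def Square.midpoint (Q : Square) (n j : ℕ) : Side → ℝ × ℝ
  | .top => (Q.x + Q.len * (((j : ℝ) - 1 / 2) / n), Q.y + Q.len)
  | .bottom => (Q.x + Q.len * (((j : ℝ) - 1 / 2) / n), Q.y)
  | .left => (Q.x, Q.y + Q.len - Q.len * (((j : ℝ) - 1 / 2) / n))
  | .right => (Q.x + Q.len, Q.y + Q.len - Q.len * (((j : ℝ) - 1 / 2) / n))

/-- `A` is a simple (Jordan) arc with end-points `a` and `b`. -/
def IsArc (A : Set (ℝ × ℝ)) (a b : ℝ × ℝ) : Prop :=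
  ∃ f : ℝ → ℝ × ℝ, ContinuousOn f (Set.Icc 0 1) ∧ Set.InjOn f (Set.Icc 0 1) ∧
    f 0 = a ∧ f 1 = b ∧ f '' Set.Icc 0 1 = A

/-- `A` is a horizontal or a vertical segment, or no two points of `A` have the same projection on
the `x`-axis and no two have the same projection on the `y`-axis. -/
def IsXYMonotone (A : Set (ℝ × ℝ)) : Prop :=
  (∃ a b : ℝ × ℝ, (a.1 = b.1 ∨ a.2 = b.2) ∧ A = segment ℝ a b) ∨
    (Set.InjOn Prod.fst A ∧ Set.InjOn Prod.snd A)

/-- The convex hull of two squares. -/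
def pipe (Q R : Square) : Set (ℝ × ℝ) := convexHull ℝ (Q.region ∪ R.region)

variable {V C : Type*}

/-- `s(u, v)` is an inter-cluster edge. -/
def ClusteredGraph.Inter (G : ClusteredGraph V C) (u v : V) : Prop :=
  G.graph.Adj u v ∧ G.cluster u ≠ G.cluster v

/-- The set of vertices of a cluster. -/
def ClusteredGraph.verts (G : ClusteredGraph V C) (c : C) : Set V := {v | G.cluster v = c}

/-- A row-column order for every cluster: it numbers the vertices of each cluster `c` bijectively
by `1, …, |c|`. -/
structure ClusteredGraph.RowColumnOrder (G : ClusteredGraph V C) where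
  pos : V → ℕ
  bijOn : ∀ c, Set.BijOn pos (G.verts c) (Set.Icc 1 (G.verts c).ncard)

/-- The incidence point at `u` of the edge `s(u, v)`. -/
noncomputable def ClusteredGraph.incidencePoint (G : ClusteredGraph V C) (σ : G.RowColumnOrder)
    (side : V → V → Side) (square : C → Square) (u v : V) : ℝ × ℝ :=
  (square (G.cluster u)).midpoint (G.verts (G.cluster u)).ncard (σ.pos u) (side u v)

/-- A NodeTrix representation. For an inter-cluster edge `s(u, v)`, `side u v` is the side of the
matrix of the cluster of `u` to which the edge is assigned; the other values of `side`, and the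
values of `drawing` outside the inter-cluster edges, are irrelevant. -/
structure Representation (G : ClusteredGraph V C) where
  order : G.RowColumnOrder
  side : V → V → Side
  square : C → Square
  disjoint : ∀ c d, c ≠ d → Disjoint (square c).region (square d).region
  drawing : Sym2 V → Set (ℝ × ℝ)
  isArc : ∀ u v, G.Inter u v → IsArc (drawing s(u, v))
    (G.incidencePoint order side square u v) (G.incidencePoint order side square v u)

namespace Representation

variable {G : ClusteredGraph V C}

/-- The incidence point at `u` of the edge `s(u, v)` in a representation. -/
noncomputable def point (Γ : Representation G) (u v : V) : ℝ × ℝ :=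
  G.incidencePoint Γ.order Γ.side Γ.square u v

/-- `Γ` is a monotone NodeTrix representation of `G` with the square assignment `γ`. -/
structure IsMonotone (Γ : Representation G) (γ : C → Square) : Prop where
  monotone : ∀ u v, G.Inter u v → IsXYMonotone (Γ.drawing s(u, v))
  square_eq : Γ.square = γ
  pipe_disjoint : ∀ u v, G.Inter u v → ∀ c, c ≠ G.cluster u → c ≠ G.cluster v →
    Disjoint (pipe (Γ.square (G.cluster u)) (Γ.square (G.cluster v))) (Γ.square c).region
  subset_pipe : ∀ u v, G.Inter u v →
    Γ.drawing s(u, v) ⊆ pipe (Γ.square (G.cluster u)) (Γ.square (G.cluster v))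

/-- Two distinct inter-cluster edges `s(u, v)` and `s(u', v')` cross: they have a common point that
is not a common end-point. -/
def Cross (Γ : Representation G) (u v u' v' : V) : Prop :=
  ∃ p ∈ Γ.drawing s(u, v) ∩ Γ.drawing s(u', v'),
    ¬ ((p = Γ.point u v ∨ p = Γ.point v u) ∧ (p = Γ.point u' v' ∨ p = Γ.point v' u'))

/-- No two inter-cluster edges incident to a common cluster cross, and no inter-cluster edge
intersects a matrix except at the incidence points of the edge. -/
structure IsLocallyPlanar (Γ : Representation G) : Prop where
  not_cross : ∀ u v u' v', G.Inter u v → G.Inter u' v' → s(u, v) ≠ s(u', v') →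
    G.cluster u = G.cluster u' → ¬ Γ.Cross u v u' v'
  avoids_matrices : ∀ u v, G.Inter u v → ∀ c, ∀ p ∈ Γ.drawing s(u, v) ∩ (Γ.square c).region,
    p = Γ.point u v ∨ p = Γ.point v u

end Representation

/-- `G` admits a monotone locally planar NodeTrix representation with the square assignment `γ`,
the row-column orders `σ` and the side assignments `side`. -/
def MonotoneLocallyPlanar (G : ClusteredGraph V C) (γ : C → Square) (σ : G.RowColumnOrder)
    (side : V → V → Side) : Prop :=
  ∃ Γ : Representation G, Γ.IsMonotone γ ∧ Γ.IsLocallyPlanar ∧ Γ.order = σ ∧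
    ∀ u v, G.Inter u v → Γ.side u v = side u v

/-! ### The decision problem -/

/-- An instance of Monotone NodeTrix Local Planarity with fixed order and fixed side: a flat
clustered graph on the vertices `0, …, n - 1` with the clusters `0, …, k - 1`, its row-column
orders and side assignments, and a square with rational coordinates for every cluster. -/
structure Instance where
  n : ℕ
  k : ℕ
  G : ClusteredGraph (Fin n) (Fin k)
  order : G.RowColumnOrder
  side : Fin n → Fin n → Side
  x : Fin k → ℚ
  y : Fin k → ℚ
  len : Fin k → ℚ
  len_pos : ∀ c, 0 < len c

/-- The square assignment of an instance. -/
noncomputable def Instance.square (I : Instance) (c : Fin I.k) : Square where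
  x := I.x c
  y := I.y c
  len := I.len c
  len_pos := by exact_mod_cast I.len_pos c

/-- The question: is there a monotone locally planar representation with the given data? -/
def Instance.IsYes (I : Instance) : Prop :=
  MonotoneLocallyPlanar I.G I.square I.order I.side

/-- Sides are presented to the machine by the numbers `0, 1, 2, 3`. -/
def Side.code : Side → ℤ
  | .top => 0
  | .bottom => 1
  | .left => 2
  | .right => 3

/-- Rational numbers are presented by numerator and denominator. -/
def ratCode (q : ℚ) : List ℤ := [q.num, (q.den : ℤ)]

open Classical in
/-- The presentation of an instance to the machine: the numbers of vertices and of clusters, the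
squares, the cluster and the position of every vertex, the adjacency matrix, and the matrix of the
sides. -/
noncomputable def Instance.encode (I : Instance) : List ℤ :=
  [(I.n : ℤ), (I.k : ℤ)] ++
    (List.finRange I.k).flatMap
      (fun c => ratCode (I.x c) ++ ratCode (I.y c) ++ ratCode (I.len c)) ++
    (List.finRange I.n).flatMap
      (fun v => [((I.G.cluster v : ℕ) : ℤ), (I.order.pos v : ℤ)]) ++
    (List.finRange I.n).flatMap
      (fun u => (List.finRange I.n).map (fun v => if I.G.graph.Adj u v then 1 else 0)) ++
    (List.finRange I.n).flatMap
      (fun u => (List.finRange I.n).map (fun v => (I.side u v).code))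

end NodeTrix

/-! ### Bounded formulas and their evaluation on the machine -/

namespace RAM

/-! An instance is positive exactly when drawing every inter-cluster edge as a straight segment
works (`Instance.isYes_iff_straight`). Whether this works is a fixed first-order condition on the
input, and one program can test it.

Straightening does no harm for the following reason. An arc that leaves its square at the mid-point
of a segment of a side must end strictly beyond the line of that side, since otherwise monotonicity
would keep it on the inner side and hence, near its start, in the square (`MonoPath.outset_pos`). So
the region swept while an arc is straightened touches the two squares of the edge only at the ends
of the arc; it also stays in the convex pipe, which misses all other squares
(`Instance.avoids_of_mem_region`). End-points of other edges lie on squares, so none is swept over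
unless it is an end of the arc itself. If the segments of two edges cross properly and neither is
vertical, both arcs are graphs, and at the ends of the common interval of abscissae the arcs lie in
the same vertical order as the segments. The height difference of disjoint arcs has no zero, so
neither has that of the segments, a contradiction (`MonoPath.exists_common`). Exchanging the
coordinates handles two non-horizontal segments, and in the remaining case of one horizontal and one
vertical segment the arcs cover the segments.

Conversely, when segments touch squares only at their own incidence points, no end-point lies inside
another segment, and the only obstruction left is a proper crossing, a sign condition on
orientations (`common_end_of_not_properCross`).

All conditions are inequalities between rational expressions in the data; for the pipes this uses
Helly's theorem on an interval (`exists_forall_nonneg`). So `Instance.Straight` is one formula, the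
same for all instances, with quantifiers over vertices only (`defProp_straight`). Each quantifier
becomes a loop with at most `n` rounds and each test costs linearly many bits, which gives a
polynomial bound (`Form.exists_exec`). -/

/-- Formulas about a state. In `all φ` the variable ranges over the natural numbers below the
content of the memory cell `0`. -/
inductive Form where
  | pos (e : Expr)
  | not (φ : Form)
  | and (φ ψ : Form)
  | all (φ : Form)

/-- Truth of a formula in which the registers `1, …, d` hold the free variables. -/
def Form.Holds (m : ℤ → ℤ) : Form → ℕ → (ℕ → ℤ) → Prop
  | .pos e, _, ρ => 0 < e.eval ⟨ρ, m⟩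
  | .not φ, d, ρ => ¬ φ.Holds m d ρ
  | .and φ ψ, d, ρ => φ.Holds m d ρ ∧ ψ.Holds m d ρ
  | .all φ, d, ρ => ∀ j : ℤ, 0 ≤ j → j < m 0 → φ.Holds m (d + 1) (Function.update ρ (d + 1) j)

/-- The body of the loop that evaluates a quantifier over the register `r`. -/
def loopBody (r : ℕ) (p : Prog) : Prog :=
  .seq (.assign r (.sub (.reg r) (.const 1)))
    -- A false instance sets the counter to `0`: the loop stops at once, with the value `0` kept in
    -- register `0`.
    (.seq p (.ite (.reg 0) .skip (.assign r (.const 0))))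

/-- A program that evaluates a formula and leaves its truth value in register `0`. -/
def Form.compile : Form → ℕ → Prog
  -- Register `0` is cleared first, so that `e` does not see the result of an earlier evaluation.
  | .pos e, _ => .seq (.assign 0 (.const 0)) (.ite e (.assign 0 (.const 1)) .skip)
  | .not φ, d => .seq (φ.compile d) (.assign 0 (.sub (.const 1) (.reg 0)))
  | .and φ ψ, d => .seq (φ.compile d) (.ite (.reg 0) (ψ.compile d) .skip)
  | .all φ, d =>
    .seq (.assign (d + 1) (.load (.const 0)))
      (.seq (.assign 0 (.const 1)) (.loop (.reg (d + 1)) (loopBody (d + 1) (φ.compile (d + 1)))))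

/-! ### Bit lengths of integers and of values of expressions. -/

theorem bits_pos (z : ℤ) : 1 ≤ bits z := by simp [bits]

theorem bits_zero : bits 0 = 1 := by simp [bits]

theorem bits_one : bits 1 = 2 := by simp [bits]

/-- Crude, but of the same form as the bounds for differences and products, so that one induction
bounds all expressions linearly. -/
theorem bits_add_le (a b : ℤ) : bits (a + b) ≤ bits a + bits b := by
  unfold bits
  have h1 : (a + b).natAbs ≤ a.natAbs + b.natAbs := Int.natAbs_add_le a b
  have : (a + b).natAbs.size ≤ a.natAbs.size + b.natAbs.size + 1 := by
    rw [Nat.size_le]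
    have ha := Nat.lt_size_self a.natAbs
    have hb := Nat.lt_size_self b.natAbs
    have h2 : 2 ^ a.natAbs.size ≤ 2 ^ (a.natAbs.size + b.natAbs.size) :=
      Nat.pow_le_pow_right (by norm_num) (by omega)
    have h3 : 2 ^ b.natAbs.size ≤ 2 ^ (a.natAbs.size + b.natAbs.size) :=
      Nat.pow_le_pow_right (by norm_num) (by omega)
    rw [pow_succ]
    omega
  omega

theorem bits_sub_le (a b : ℤ) : bits (a - b) ≤ bits a + bits b := by
  have := bits_add_le a (-b)
  simpa [bits, sub_eq_add_neg] using this

theorem bits_mul_le (a b : ℤ) : bits (a * b) ≤ bits a + bits b := by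
  unfold bits
  have : (a * b).natAbs.size ≤ a.natAbs.size + b.natAbs.size := by
    rw [Nat.size_le, Int.natAbs_mul, pow_add]
    exact Nat.mul_lt_mul'' (Nat.lt_size_self _) (Nat.lt_size_self _)
  omega

theorem bits_le_of_nonneg {z : ℤ} {N : ℕ} (h0 : 0 ≤ z) (h : z < N) : bits z ≤ N := by
  unfold bits
  have h1 : z.natAbs < N := by omega
  have : z.natAbs.size ≤ z.natAbs := by
    rw [Nat.size_le]; exact Nat.lt_two_pow_self
  omega

/-- The value and the cost of an expression are linear in the number of bits of the cells. -/
theorem Expr.exists_bound (e : Expr) : ∃ K : ℕ, ∀ (s : State) (N : ℕ), 1 ≤ N →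
    (∀ r, bits (s.reg r) ≤ N) → (∀ a, bits (s.mem a) ≤ N) →
      bits (e.eval s) ≤ K * N ∧ e.cost s ≤ K * N := by
  induction e with
  | const z =>
    refine ⟨bits z, fun s N hN _ _ => ?_⟩
    simp only [Expr.eval, Expr.cost]
    exact ⟨Nat.le_mul_of_pos_right _ hN, Nat.le_mul_of_pos_right _ hN⟩
  | reg r => exact ⟨1, fun s N hN hr _ => by simpa [Expr.eval, Expr.cost] using hr r⟩
  | load a ih =>
    obtain ⟨K, hK⟩ := ih
    refine ⟨K + 1, fun s N hN hr hm => ?_⟩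
    have h1 := hK s N hN hr hm
    have h2 := hm (a.eval s)
    simp only [Expr.eval, Expr.cost, add_mul, one_mul]
    omega
  | add a b iha ihb =>
    obtain ⟨K, hK⟩ := iha
    obtain ⟨K', hK'⟩ := ihb
    refine ⟨2 * (K + K'), fun s N hN hr hm => ?_⟩
    have h1 := hK s N hN hr hm
    have h2 := hK' s N hN hr hm
    have h3 := bits_add_le (a.eval s) (b.eval s)
    simp only [Expr.eval, Expr.cost, add_mul, mul_assoc]
    omega
  | sub a b iha ihb =>
    obtain ⟨K, hK⟩ := iha
    obtain ⟨K', hK'⟩ := ihb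
    refine ⟨2 * (K + K'), fun s N hN hr hm => ?_⟩
    have h1 := hK s N hN hr hm
    have h2 := hK' s N hN hr hm
    have h3 := bits_sub_le (a.eval s) (b.eval s)
    simp only [Expr.eval, Expr.cost, add_mul, mul_assoc]
    omega
  | mul a b iha ihb =>
    obtain ⟨K, hK⟩ := iha
    obtain ⟨K', hK'⟩ := ihb
    refine ⟨2 * (K + K'), fun s N hN hr hm => ?_⟩
    have h1 := hK s N hN hr hm
    have h2 := hK' s N hN hr hm
    have h3 := bits_mul_le (a.eval s) (b.eval s)
    simp only [Expr.eval, Expr.cost, add_mul, mul_assoc]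
    omega

/-! ### Execution of compiled formulas. -/

open Classical in
/-- The truth value of a proposition as an integer. -/
noncomputable def truth (P : Prop) : ℤ := if P then 1 else 0

theorem truth_of {P : Prop} (h : P) : truth P = 1 := by simp [truth, h]

theorem truth_of_not {P : Prop} (h : ¬ P) : truth P = 0 := by simp [truth, h]

theorem bits_truth_le (P : Prop) : bits (truth P) ≤ 2 := by
  by_cases h : P <;> simp [truth, h, bits_zero, bits_one]

theorem Exec.cast {p : Prog} {s s₁ s₂ : State} {t : ℕ} (h : Exec p s t s₁) (hs : s₁ = s₂) :
    Exec p s t s₂ := hs ▸ h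

/-- The loop that evaluates a quantifier. -/
theorem exec_loop {p : Prog} {d B N : ℕ} {m : ℤ → ℤ} {ρ : ℕ → ℤ} {P : ℤ → Prop}
    (h0 : m 0 ≤ N) (hρ : ρ (d + 1) = 0)
    (hp : ∀ j : ℤ, 0 ≤ j → j < m 0 → ∃ t ≤ B,
      Exec p ⟨Function.update (Function.update ρ (d + 1) j) 0 1, m⟩ t
        ⟨Function.update (Function.update ρ (d + 1) j) 0 (truth (P j)), m⟩)
    (i : ℕ) (hi : (i : ℤ) ≤ m 0) :
    ∃ t ≤ (i + 1) * (B + 4 * N + 20),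
      Exec (.loop (.reg (d + 1)) (loopBody (d + 1) p))
        ⟨Function.update (Function.update ρ (d + 1) i) 0 1, m⟩ t
        ⟨Function.update ρ 0 (truth (∀ j : ℤ, 0 ≤ j → j < i → P j)), m⟩ := by
  have hd : d + 1 ≠ 0 := Nat.succ_ne_zero d
  induction i with
  | zero =>
    -- The counter has come down to the value `0` that `ρ` has in this register, so the loop leaves
    -- no trace except in register `0`.
    have hup : Function.update ρ (d + 1) ((0 : ℕ) : ℤ) = ρ := by simp [hρ.symm]
    rw [hup]
    refine ⟨_, ?_, Exec.cast (.loop_neg ?_) ?_⟩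
    · simp [Expr.cost, hρ, bits_zero]
    · simp [Expr.eval, hρ]
    · rw [truth_of (by intro j h1 h2; simp at h2; omega)]
  | succ i ih =>
    have hi' : (i : ℤ) < m 0 := by push_cast at hi; omega
    obtain ⟨t₁, ht₁, hE⟩ := hp i (by positivity) hi'
    have hbits : bits ((i : ℤ) + 1) ≤ N + 1 := bits_le_of_nonneg (by positivity) (by push_cast; omega)
    have hbits' : bits (i : ℤ) ≤ N := bits_le_of_nonneg (by positivity) (by omega)
    have hdec : Exec (.assign (d + 1) (.sub (.reg (d + 1)) (.const 1)))
        ⟨Function.update (Function.update ρ (d + 1) ((i + 1 : ℕ) : ℤ)) 0 1, m⟩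
        (bits ((i : ℤ) + 1) + 2 + bits (i : ℤ) + 1)
        ⟨Function.update (Function.update ρ (d + 1) (i : ℤ)) 0 1, m⟩ := by
      have := Exec.assign (d + 1) (.sub (.reg (d + 1)) (.const 1))
        ⟨Function.update (Function.update ρ (d + 1) ((i + 1 : ℕ) : ℤ)) 0 1, m⟩
      simp only [Expr.cost, Expr.eval, ne_eq, hd, not_false_eq_true, Function.update_of_ne,
        Function.update_self, Nat.cast_add, Nat.cast_one, bits_one, add_sub_cancel_right,
        State.setReg] at this
      rw [Function.update_comm hd.symm, Function.update_idem] at this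
      simpa using this
    have hpos : 0 < (Expr.reg (d + 1)).eval
        ⟨Function.update (Function.update ρ (d + 1) ((i + 1 : ℕ) : ℤ)) 0 1, m⟩ := by
      simp [Expr.eval]
    have hcost : (Expr.reg (d + 1)).cost
        ⟨Function.update (Function.update ρ (d + 1) ((i + 1 : ℕ) : ℤ)) 0 1, m⟩
          = bits ((i : ℤ) + 1) := by
      simp [Expr.cost]
    by_cases hP : P i
    · rw [truth_of hP] at hE
      obtain ⟨t₂, ht₂, hL⟩ := ih hi'.le
      have hite := Exec.ite_pos (e := .reg 0) (q := .assign (d + 1) (.const 0))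
        (s := ⟨Function.update (Function.update ρ (d + 1) (i : ℤ)) 0 1, m⟩)
        (by simp [Expr.eval]) (Exec.skip _)
      refine ⟨_, ?_, Exec.cast (.loop_pos hpos (.seq hdec (.seq hE hite)) hL) ?_⟩
      · rw [hcost]
        simp only [Expr.cost, Function.update_self, bits_one]
        -- Splits off one share `B + 4 * N + 20`, which pays for the test, the decrement and the
        -- body of this round.
        rw [add_mul (i + 1 : ℕ) 1]
        omega
      · congr 3
        simp only [eq_iff_iff]
        refine ⟨fun h j h1 h2 => ?_, fun h j h1 h2 => h j h1 (by push_cast; omega)⟩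
        rcases eq_or_ne j i with rfl | hj
        · exact hP
        · exact h j h1 (by push_cast at h2; omega)
    · rw [truth_of_not hP] at hE
      have hite := Exec.ite_neg (e := .reg 0) (p := .skip)
        (s := ⟨Function.update (Function.update ρ (d + 1) (i : ℤ)) 0 0, m⟩)
        (by simp [Expr.eval]) (Exec.assign (d + 1) (.const 0) _)
      have hst : State.setReg ⟨Function.update (Function.update ρ (d + 1) (i : ℤ)) 0 0, m⟩
          (d + 1) ((Expr.const 0).eval
            ⟨Function.update (Function.update ρ (d + 1) (i : ℤ)) 0 0, m⟩)
          = ⟨Function.update ρ 0 0, m⟩ := by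
        simp only [State.setReg, Expr.eval]
        rw [Function.update_comm hd.symm, Function.update_idem, ← hρ, Function.update_eq_self]
      rw [hst] at hite
      -- After an aborted round the counter is `0`, so one more test ends the loop.
      have hend := Exec.loop_neg (e := .reg (d + 1)) (p := loopBody (d + 1) p)
        (s := ⟨Function.update ρ 0 0, m⟩) (by simp [Expr.eval, hρ])
      refine ⟨_, ?_, Exec.cast (.loop_pos hpos (.seq hdec (.seq hE hite)) hend) ?_⟩
      · rw [hcost]
        simp only [Expr.cost, Function.update_self, bits_zero, ne_eq, hd, not_false_eq_true,
          Function.update_of_ne, hρ]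
        rw [add_mul (i + 1 : ℕ) 1]
        omega
      · rw [truth_of_not]
        intro h
        exact hP (h i (by positivity) (by push_cast; omega))

/-- The compiled program evaluates the formula in polynomial time. -/
theorem Form.exists_exec (φ : Form) : ∀ d : ℕ, ∃ T : Polynomial ℕ, ∀ (N : ℕ) (m : ℤ → ℤ)
    (ρ : ℕ → ℤ) (z : ℤ), 2 ≤ N → (∀ a, bits (m a) ≤ N) → 0 ≤ m 0 → m 0 ≤ N →
      (∀ r, bits (ρ r) ≤ N) → ρ 0 = 0 → (∀ r, d < r → ρ r = 0) → bits z ≤ 2 →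
        ∃ t ≤ T.eval N, Exec (φ.compile d) ⟨Function.update ρ 0 z, m⟩ t
          ⟨Function.update ρ 0 (truth (φ.Holds m d ρ)), m⟩ := by
  induction φ with
  | pos e =>
    intro d
    obtain ⟨K, hK⟩ := e.exists_bound
    refine ⟨Polynomial.C K * Polynomial.X + Polynomial.C 10,
      fun N m ρ z hN hm _ _ hρ hρ0 _ hz => ?_⟩
    have h0 : Function.update ρ 0 0 = ρ := by rw [← hρ0, Function.update_eq_self]
    have hset : Exec (.assign 0 (.const 0)) ⟨Function.update ρ 0 z, m⟩ 2 ⟨ρ, m⟩ :=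
      Exec.cast (.assign 0 (.const 0) _) (by simp [State.setReg, Expr.eval, h0])
    have hc := (hK ⟨ρ, m⟩ N (by omega) hρ hm).2
    simp only [Form.Holds]
    by_cases he : 0 < e.eval ⟨ρ, m⟩
    · refine ⟨_, ?_, Exec.cast (.seq hset (.ite_pos he (.assign 0 (.const 1) _))) ?_⟩
      · simp [Expr.cost, bits_one]; omega
      · rw [truth_of he]; rfl
    · refine ⟨_, ?_, Exec.cast (.seq hset (.ite_neg he (.skip _))) ?_⟩
      · simp; omega
      · rw [truth_of_not he, h0]
  | not φ ih =>
    intro d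
    obtain ⟨T, hT⟩ := ih d
    refine ⟨T + Polynomial.C 10, fun N m ρ z hN hm h0 h0' hρ hρ0 hρd hz => ?_⟩
    obtain ⟨t, ht, hE⟩ := hT N m ρ z hN hm h0 h0' hρ hρ0 hρd hz
    refine ⟨_, ?_, Exec.cast (.seq hE (.assign 0 _ _)) ?_⟩
    · have h1 := bits_truth_le (φ.Holds m d ρ)
      have h2 := bits_sub_le 1 (truth (φ.Holds m d ρ))
      simp only [Expr.cost, Expr.eval, Function.update_self, bits_one, Polynomial.eval_add,
        Polynomial.eval_C] at h2 ⊢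
      omega
    · simp only [State.setReg, Expr.eval, Function.update_self, Function.update_idem, Form.Holds]
      by_cases h : φ.Holds m d ρ
      · rw [truth_of h, truth_of_not (not_not.2 h)]; rfl
      · rw [truth_of_not h, truth_of h]; rfl
  | and φ ψ ihφ ihψ =>
    intro d
    obtain ⟨T, hT⟩ := ihφ d
    obtain ⟨T', hT'⟩ := ihψ d
    refine ⟨T + T' + Polynomial.C 10, fun N m ρ z hN hm h0 h0' hρ hρ0 hρd hz => ?_⟩
    obtain ⟨t, ht, hE⟩ := hT N m ρ z hN hm h0 h0' hρ hρ0 hρd hz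
    simp only [Form.Holds, Polynomial.eval_add, Polynomial.eval_C]
    by_cases h : φ.Holds m d ρ
    · rw [truth_of h] at hE
      obtain ⟨t', ht', hE'⟩ := hT' N m ρ 1 hN hm h0 h0' hρ hρ0 hρd (by simp [bits_one])
      refine ⟨_, ?_, Exec.cast (.seq hE (.ite_pos (by simp [Expr.eval]) hE')) ?_⟩
      · simp [Expr.cost, bits_one]; omega
      · simp [h]
    · rw [truth_of_not h] at hE
      refine ⟨_, ?_, Exec.cast (.seq hE (.ite_neg (by simp [Expr.eval]) (.skip _))) ?_⟩
      · simp [Expr.cost, bits_zero]; omega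
      · rw [truth_of_not (fun h' => h h'.1)]
  | all φ ih =>
    intro d
    obtain ⟨T, hT⟩ := ih (d + 1)
    -- At most `N` rounds because `m 0 ≤ N`, and one final test; the nesting depth is fixed by the
    -- formula, so the bound stays polynomial.
    refine ⟨(Polynomial.X + 1) * (T + Polynomial.C 4 * Polynomial.X + Polynomial.C 20)
      + Polynomial.X + Polynomial.C 10, fun N m ρ z hN hm h0 h0' hρ hρ0 hρd hz => ?_⟩
    obtain ⟨n, hn⟩ := Int.eq_ofNat_of_zero_le h0
    have hd : d + 1 ≠ 0 := Nat.succ_ne_zero d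
    have hset : Exec (.assign (d + 1) (.load (.const 0))) ⟨Function.update ρ 0 z, m⟩
        (1 + bits (m 0) + 1) ⟨Function.update (Function.update ρ (d + 1) n) 0 z, m⟩ := by
      have := Exec.assign (d + 1) (.load (.const 0)) ⟨Function.update ρ 0 z, m⟩
      simp only [Expr.cost, Expr.eval, bits_zero, State.setReg] at this
      rw [Function.update_comm hd.symm] at this
      rwa [← hn]
    have hone : Exec (.assign 0 (.const 1))
        ⟨Function.update (Function.update ρ (d + 1) n) 0 z, m⟩ 3
        ⟨Function.update (Function.update ρ (d + 1) n) 0 1, m⟩ := by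
      refine Exec.cast (.assign 0 (.const 1) _) ?_
      simp [State.setReg, Expr.eval]
    obtain ⟨t, ht, hL⟩ := exec_loop (p := φ.compile (d + 1)) (d := d) (B := T.eval N) (m := m)
      (ρ := ρ) (P := fun j => φ.Holds m (d + 1) (Function.update ρ (d + 1) j)) h0'
      (hρd _ (Nat.lt_succ_self d)) (fun j hj hj' => by
        refine hT N m (Function.update ρ (d + 1) j) 1 hN hm h0 h0' (fun r => ?_) ?_ (fun r hr => ?_)
          (by simp [bits_one])
        · rcases eq_or_ne r (d + 1) with rfl | hr
          · simpa using bits_le_of_nonneg hj (by omega)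
          · simpa [hr] using hρ r
        · rw [Function.update_of_ne hd.symm, hρ0]
        · rw [Function.update_of_ne (by omega), hρd r (by omega)]) n (by omega)
    refine ⟨_, ?_, Exec.cast (.seq hset (.seq hone hL)) ?_⟩
    · have h1 := hm 0
      have h2 : (n + 1) * (T.eval N + 4 * N + 20) ≤ (N + 1) * (T.eval N + 4 * N + 20) :=
        Nat.mul_le_mul_right _ (by omega)
      simp only [Polynomial.eval_add, Polynomial.eval_mul, Polynomial.eval_X, Polynomial.eval_one,
        Polynomial.eval_C]
      omega
    · simp only [Form.Holds, hn]

end RAM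

/-! ### Definability of data of an instance by expressions and formulas -/

namespace NodeTrix

open RAM (Expr Form)

/-- The content of the memory when the machine starts on an instance. -/
noncomputable def Instance.memory (I : Instance) : ℤ → ℤ := (RAM.init I.encode).mem

theorem Instance.memory_natCast (I : Instance) (a : ℕ) : I.memory a = I.encode.getD a 0 := by
  simp [memory, RAM.init]

/-! ### Layout of the input: 2 cells for `n` and `k`, 6 per cluster, 2 per vertex, then two `n × n`
matrices. -/

theorem getD_flatMap_of_length {α : Type*} {l : List α} {f : α → List ℤ} {L : ℕ}
    (h : ∀ a, (f a).length = L) {i j : ℕ} (hi : i < l.length) (hj : j < L) :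
    (l.flatMap f).getD (L * i + j) 0 = (f l[i]).getD j 0 := by
  induction l generalizing i with
  | nil => simp at hi
  | cons a l ih =>
    rw [List.flatMap_cons]
    cases i with
    | zero => rw [mul_zero, zero_add, List.getD_append _ _ _ _ (by rw [h]; exact hj)]; rfl
    | succ i =>
      rw [List.getD_append_right _ _ _ _ (by rw [h]; nlinarith), h,
        show L * (i + 1) + j - L = L * i + j by rw [mul_add, mul_one]; omega]
      exact ih (by simpa using hi)

theorem length_flatMap_of_length {α : Type*} {l : List α} {f : α → List ℤ} {L : ℕ}
    (h : ∀ a, (f a).length = L) : (l.flatMap f).length = L * l.length := by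
  induction l with
  | nil => simp
  | cons a l ih => rw [List.flatMap_cons, List.length_append, h, ih, List.length_cons]; ring

theorem getD_flatMap_finRange {n L : ℕ} {f : Fin n → List ℤ} (h : ∀ a, (f a).length = L)
    (c : Fin n) {j : ℕ} (hj : j < L) :
    ((List.finRange n).flatMap f).getD (L * c + j) 0 = (f c).getD j 0 := by
  rw [getD_flatMap_of_length h (by simp) hj]
  simp

theorem length_flatMap_finRange {n L : ℕ} {f : Fin n → List ℤ} (h : ∀ a, (f a).length = L) :
    ((List.finRange n).flatMap f).length = L * n := by
  rw [length_flatMap_of_length h, List.length_finRange]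

section Memory

variable (I : Instance)

theorem Instance.length_squares : ((List.finRange I.k).flatMap
    (fun c => ratCode (I.x c) ++ ratCode (I.y c) ++ ratCode (I.len c))).length = 6 * I.k :=
  length_flatMap_finRange fun _ => rfl

theorem Instance.length_vertices : ((List.finRange I.n).flatMap
    (fun v => [((I.G.cluster v : ℕ) : ℤ), (I.order.pos v : ℤ)])).length = 2 * I.n :=
  length_flatMap_finRange fun _ => rfl

theorem length_matrix {n : ℕ} (f : Fin n → Fin n → ℤ) : ((List.finRange n).flatMap
    (fun u => (List.finRange n).map (f u))).length = n * n :=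
  length_flatMap_finRange fun _ => by simp

theorem getD_matrix {n : ℕ} (f : Fin n → Fin n → ℤ) (u v : Fin n) : ((List.finRange n).flatMap
    (fun u => (List.finRange n).map (f u))).getD (n * u + v) 0 = f u v := by
  rw [getD_flatMap_finRange (fun _ => by simp) u v.2]
  simp [List.getD_eq_getElem?_getD]

theorem Instance.memory_zero : I.memory 0 = I.n := by
  have := I.memory_natCast 0
  simpa [encode] using this

theorem Instance.memory_one : I.memory 1 = I.k := by
  have := I.memory_natCast 1
  simpa [encode] using this

theorem Instance.memory_square (c : Fin I.k) {j : ℕ} (hj : j < 6) :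
    I.memory (2 + 6 * ((c : ℕ) : ℤ) + j)
      = (ratCode (I.x c) ++ ratCode (I.y c) ++ ratCode (I.len c)).getD j 0 := by
  have hc := c.2
  have := I.memory_natCast (2 + (6 * c + j))
  have hlen : ([(I.n : ℤ), (I.k : ℤ)] ++ (List.finRange I.k).flatMap
      (fun c => ratCode (I.x c) ++ ratCode (I.y c) ++ ratCode (I.len c))).length
        = 2 + 6 * I.k := by rw [List.length_append, I.length_squares]; rfl
  rw [encode, List.getD_append _ _ _ _ (by
      rw [List.length_append, List.length_append, hlen, I.length_vertices]; omega),
    List.getD_append _ _ _ _ (by rw [List.length_append, hlen, I.length_vertices]; omega),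
    List.getD_append _ _ _ _ (by rw [hlen]; omega),
    List.getD_append_right _ _ _ _ (by simp)] at this
  simp only [List.length_cons, List.length_nil, zero_add, Nat.reduceAdd,
    Nat.add_sub_cancel_left] at this
  rw [getD_flatMap_finRange (L := 6) (fun _ => rfl) c hj] at this
  rw [← this]
  push_cast
  ring_nf

theorem Instance.memory_vertex (v : Fin I.n) {j : ℕ} (hj : j < 2) :
    I.memory (2 + 6 * (I.k : ℤ) + 2 * ((v : ℕ) : ℤ) + j)
      = [((I.G.cluster v : ℕ) : ℤ), (I.order.pos v : ℤ)].getD j 0 := by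
  have hv := v.2
  have := I.memory_natCast (2 + 6 * I.k + (2 * v + j))
  have hlen : ([(I.n : ℤ), (I.k : ℤ)] ++ (List.finRange I.k).flatMap
      (fun c => ratCode (I.x c) ++ ratCode (I.y c) ++ ratCode (I.len c))).length
        = 2 + 6 * I.k := by rw [List.length_append, I.length_squares]; rfl
  rw [encode, List.getD_append _ _ _ _ (by
      rw [List.length_append, List.length_append, hlen, I.length_vertices]; omega),
    List.getD_append _ _ _ _ (by
      rw [List.length_append, hlen, I.length_vertices]; omega),
    List.getD_append_right _ _ _ _ (by rw [hlen]; omega), hlen, Nat.add_sub_cancel_left,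
    getD_flatMap_finRange (L := 2) (fun _ => rfl) v hj] at this
  rw [← this]
  push_cast
  ring_nf

open Classical in
theorem Instance.memory_adj (u v : Fin I.n) :
    I.memory (2 + 6 * (I.k : ℤ) + 2 * (I.n : ℤ) + (I.n * ((u : ℕ) : ℤ) + ((v : ℕ) : ℤ)))
      = if I.G.graph.Adj u v then 1 else 0 := by
  have huv : I.n * u + v < I.n * I.n := by
    have := u.2; have := v.2; nlinarith
  have := I.memory_natCast (2 + 6 * I.k + 2 * I.n + (I.n * u + v))
  have hlen : ([(I.n : ℤ), (I.k : ℤ)] ++ (List.finRange I.k).flatMap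
      (fun c => ratCode (I.x c) ++ ratCode (I.y c) ++ ratCode (I.len c)) ++
      (List.finRange I.n).flatMap
        (fun v => [((I.G.cluster v : ℕ) : ℤ), (I.order.pos v : ℤ)])).length
        = 2 + 6 * I.k + 2 * I.n := by
    rw [List.length_append, List.length_append, I.length_squares, I.length_vertices]; rfl
  rw [encode, List.getD_append _ _ _ _ (by
      rw [List.length_append, hlen, length_matrix]; omega),
    List.getD_append_right _ _ _ _ (by rw [hlen]; omega), hlen, Nat.add_sub_cancel_left,
    getD_matrix] at this
  rw [← this]
  push_cast
  ring_nf

theorem Instance.memory_side (u v : Fin I.n) :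
    I.memory (2 + 6 * (I.k : ℤ) + 2 * (I.n : ℤ) + I.n * I.n
      + (I.n * ((u : ℕ) : ℤ) + ((v : ℕ) : ℤ))) = (I.side u v).code := by
  classical
  have := I.memory_natCast (2 + 6 * I.k + 2 * I.n + I.n * I.n + (I.n * u + v))
  have hlen : ([(I.n : ℤ), (I.k : ℤ)] ++ (List.finRange I.k).flatMap
      (fun c => ratCode (I.x c) ++ ratCode (I.y c) ++ ratCode (I.len c)) ++
      (List.finRange I.n).flatMap
        (fun v => [((I.G.cluster v : ℕ) : ℤ), (I.order.pos v : ℤ)]) ++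
      (List.finRange I.n).flatMap
        (fun u => (List.finRange I.n).map
          (fun v => if I.G.graph.Adj u v then (1 : ℤ) else 0))).length
        = 2 + 6 * I.k + 2 * I.n + I.n * I.n := by
    rw [List.length_append, List.length_append, List.length_append, I.length_squares,
      I.length_vertices, length_matrix]; rfl
  rw [encode, List.getD_append_right _ _ _ _ (by rw [hlen]; omega), hlen,
    Nat.add_sub_cancel_left, getD_matrix] at this
  rw [← this]
  push_cast
  ring_nf

end Memory

/-! ### Definability by expressions and formulas that do not depend on the instance. -/

/-- A context: the possible values of some variables, and their storage in registers. -/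
structure Ctx where
  carrier : Instance → Type
  depth : ℕ
  env : ∀ I, carrier I → ℕ → ℤ

/-- The context without variables. -/
def Ctx.empty : Ctx := ⟨fun _ => Unit, 0, fun _ _ _ => 0⟩

/-- The context with one more variable, for a vertex. -/
def Ctx.ext (Γ : Ctx) : Ctx :=
  ⟨fun I => Γ.carrier I × Fin I.n, Γ.depth + 1,
    fun I γ => Function.update (Γ.env I γ.1) (Γ.depth + 1) ((γ.2 : ℕ) : ℤ)⟩

/-- The machine state that describes an instance and the values of the variables. -/
noncomputable def Ctx.state (Γ : Ctx) (I : Instance) (γ : Γ.carrier I) : RAM.State :=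
  ⟨Γ.env I γ, I.memory⟩

/-- `u` is one of the variables of the context. -/
def IsVar (Γ : Ctx) (u : ∀ I, Γ.carrier I → Fin I.n) : Prop :=
  ∃ r ≤ Γ.depth, ∀ I γ, Γ.env I γ r = ((u I γ : ℕ) : ℤ)

theorem IsVar.last {Γ : Ctx} : IsVar Γ.ext (fun _ γ => γ.2) :=
  ⟨Γ.depth + 1, le_rfl, fun I γ => by simp [Ctx.ext]⟩

/-- A new variable is written to the register after `Γ.depth` only, and older variables sit at or
below this index. -/
theorem IsVar.weaken {Γ : Ctx} {u : ∀ I, Γ.carrier I → Fin I.n} (hu : IsVar Γ u) :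
    IsVar Γ.ext (fun I γ => u I γ.1) := by
  obtain ⟨r, hr, h⟩ := hu
  refine ⟨r, Nat.le_succ_of_le hr, fun I γ => ?_⟩
  rw [← h]
  exact Function.update_of_ne (by omega) _ _

/-- An integer that is given by an expression. -/
def DefInt (Γ : Ctx) (f : ∀ I, Γ.carrier I → ℤ) : Prop :=
  ∃ e : Expr, ∀ I γ, e.eval (Γ.state I γ) = f I γ

/-- A real number that is given as a fraction by two expressions. -/
def DefReal (Γ : Ctx) (f : ∀ I, Γ.carrier I → ℝ) : Prop :=
  ∃ a b : Expr, ∀ I γ, 0 < b.eval (Γ.state I γ) ∧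
    f I γ * (b.eval (Γ.state I γ) : ℝ) = (a.eval (Γ.state I γ) : ℝ)

/-- A proposition that is given by a formula. -/
def DefProp (Γ : Ctx) (P : ∀ I, Γ.carrier I → Prop) : Prop :=
  ∃ φ : Form, ∀ I γ, φ.Holds I.memory Γ.depth (Γ.env I γ) ↔ P I γ

section Closure

variable {Γ : Ctx}

theorem DefInt.const (z : ℤ) : DefInt Γ (fun _ _ => z) := ⟨.const z, fun _ _ => rfl⟩

theorem DefInt.of_isVar {u : ∀ I, Γ.carrier I → Fin I.n} (hu : IsVar Γ u) :
    DefInt Γ (fun I γ => ((u I γ : ℕ) : ℤ)) := by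
  obtain ⟨r, _, h⟩ := hu
  exact ⟨.reg r, h⟩

theorem DefInt.add {f g : ∀ I, Γ.carrier I → ℤ} (hf : DefInt Γ f) (hg : DefInt Γ g) :
    DefInt Γ (fun I γ => f I γ + g I γ) := by
  obtain ⟨a, ha⟩ := hf
  obtain ⟨b, hb⟩ := hg
  exact ⟨.add a b, fun I γ => by simp [Expr.eval, ha, hb]⟩

theorem DefInt.sub {f g : ∀ I, Γ.carrier I → ℤ} (hf : DefInt Γ f) (hg : DefInt Γ g) :
    DefInt Γ (fun I γ => f I γ - g I γ) := by
  obtain ⟨a, ha⟩ := hf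
  obtain ⟨b, hb⟩ := hg
  exact ⟨.sub a b, fun I γ => by simp [Expr.eval, ha, hb]⟩

theorem DefInt.mul {f g : ∀ I, Γ.carrier I → ℤ} (hf : DefInt Γ f) (hg : DefInt Γ g) :
    DefInt Γ (fun I γ => f I γ * g I γ) := by
  obtain ⟨a, ha⟩ := hf
  obtain ⟨b, hb⟩ := hg
  exact ⟨.mul a b, fun I γ => by simp [Expr.eval, ha, hb]⟩

theorem DefInt.memory {f : ∀ I, Γ.carrier I → ℤ} (hf : DefInt Γ f) :
    DefInt Γ (fun I γ => I.memory (f I γ)) := by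
  obtain ⟨a, ha⟩ := hf
  exact ⟨.load a, fun I γ => by rw [Expr.eval, ha]; rfl⟩

theorem DefInt.congr {f g : ∀ I, Γ.carrier I → ℤ} (hf : DefInt Γ f)
    (h : ∀ I γ, f I γ = g I γ) : DefInt Γ g := by
  obtain ⟨a, ha⟩ := hf
  exact ⟨a, fun I γ => (ha I γ).trans (h I γ)⟩

theorem DefInt.numVertices : DefInt Γ (fun I _ => (I.n : ℤ)) :=
  (DefInt.memory (.const 0)).congr fun I _ => I.memory_zero

theorem DefInt.numClusters : DefInt Γ (fun I _ => (I.k : ℤ)) :=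
  (DefInt.memory (.const 1)).congr fun I _ => I.memory_one

section Vertices

variable {u v : ∀ I, Γ.carrier I → Fin I.n} (hu : IsVar Γ u) (hv : IsVar Γ v)
include hu

theorem DefInt.cluster : DefInt Γ (fun I γ => ((I.G.cluster (u I γ) : ℕ) : ℤ)) :=
  ((((DefInt.const 2).add ((DefInt.const 6).mul .numClusters)).add
    ((DefInt.const 2).mul (.of_isVar hu))).add (.const (0 : ℕ))).memory.congr fun I _ =>
      I.memory_vertex _ (by norm_num)

theorem DefInt.pos : DefInt Γ (fun I γ => (I.order.pos (u I γ) : ℤ)) :=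
  ((((DefInt.const 2).add ((DefInt.const 6).mul .numClusters)).add
    ((DefInt.const 2).mul (.of_isVar hu))).add (.const (1 : ℕ))).memory.congr fun I _ =>
      I.memory_vertex _ (by norm_num)

theorem DefInt.squareCell {j : ℕ} (hj : j < 6) : DefInt Γ (fun I γ =>
    (ratCode (I.x (I.G.cluster (u I γ))) ++ ratCode (I.y (I.G.cluster (u I γ))) ++
      ratCode (I.len (I.G.cluster (u I γ)))).getD j 0) :=
  ((((DefInt.const 2).add ((DefInt.const 6).mul (.cluster hu))).add (.const j))).memory.congr
    fun I _ => I.memory_square _ hj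

include hv

theorem DefInt.sideCode : DefInt Γ (fun I γ => (I.side (u I γ) (v I γ)).code) :=
  (((((DefInt.const 2).add ((DefInt.const 6).mul .numClusters)).add
    ((DefInt.const 2).mul .numVertices)).add (.mul .numVertices .numVertices)).add
      ((DefInt.numVertices.mul (.of_isVar hu)).add (.of_isVar hv))).memory.congr fun I _ =>
        I.memory_side _ _

end Vertices

theorem DefReal.congr {f g : ∀ I, Γ.carrier I → ℝ} (hf : DefReal Γ f)
    (h : ∀ I γ, f I γ = g I γ) : DefReal Γ g := by
  obtain ⟨a, b, hab⟩ := hf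
  exact ⟨a, b, fun I γ => h I γ ▸ hab I γ⟩

theorem DefReal.div_int {f g : ∀ I, Γ.carrier I → ℤ} (hf : DefInt Γ f) (hg : DefInt Γ g)
    (h : ∀ I γ, 0 < g I γ) : DefReal Γ (fun I γ => (f I γ : ℝ) / (g I γ : ℝ)) := by
  obtain ⟨a, ha⟩ := hf
  obtain ⟨b, hb⟩ := hg
  refine ⟨a, b, fun I γ => ?_⟩
  have h' := h I γ
  have : (g I γ : ℝ) ≠ 0 := by exact_mod_cast h'.ne'
  rw [ha, hb]
  exact ⟨h', div_mul_cancel₀ _ this⟩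

theorem DefReal.of_int {f : ∀ I, Γ.carrier I → ℤ} (hf : DefInt Γ f) :
    DefReal Γ (fun I γ => (f I γ : ℝ)) :=
  (DefReal.div_int hf (.const 1) fun _ _ => one_pos).congr fun _ _ => by simp

theorem DefReal.const_int (z : ℤ) : DefReal Γ (fun _ _ => (z : ℝ)) := .of_int (.const z)

theorem DefReal.add {f g : ∀ I, Γ.carrier I → ℝ} (hf : DefReal Γ f) (hg : DefReal Γ g) :
    DefReal Γ (fun I γ => f I γ + g I γ) := by
  obtain ⟨a, b, h⟩ := hf
  obtain ⟨a', b', h'⟩ := hg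
  refine ⟨.add (.mul a b') (.mul a' b), .mul b b', fun I γ => ⟨?_, ?_⟩⟩
  · exact mul_pos (h I γ).1 (h' I γ).1
  · simp only [Expr.eval, Int.cast_mul, Int.cast_add, ← (h I γ).2, ← (h' I γ).2]
    ring

theorem DefReal.mul {f g : ∀ I, Γ.carrier I → ℝ} (hf : DefReal Γ f) (hg : DefReal Γ g) :
    DefReal Γ (fun I γ => f I γ * g I γ) := by
  obtain ⟨a, b, h⟩ := hf
  obtain ⟨a', b', h'⟩ := hg
  refine ⟨.mul a a', .mul b b', fun I γ => ⟨?_, ?_⟩⟩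
  · exact mul_pos (h I γ).1 (h' I γ).1
  · simp only [Expr.eval, Int.cast_mul, ← (h I γ).2, ← (h' I γ).2]
    ring

theorem DefReal.sub {f g : ∀ I, Γ.carrier I → ℝ} (hf : DefReal Γ f) (hg : DefReal Γ g) :
    DefReal Γ (fun I γ => f I γ - g I γ) :=
  (hf.add ((DefReal.const_int (-1)).mul hg)).congr fun _ _ => by push_cast; ring

theorem DefProp.congr {P R : ∀ I, Γ.carrier I → Prop} (hP : DefProp Γ P)
    (h : ∀ I γ, P I γ ↔ R I γ) : DefProp Γ R := by
  obtain ⟨φ, hφ⟩ := hP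
  exact ⟨φ, fun I γ => (hφ I γ).trans (h I γ)⟩

theorem DefProp.lt_int {f g : ∀ I, Γ.carrier I → ℤ} (hf : DefInt Γ f) (hg : DefInt Γ g) :
    DefProp Γ (fun I γ => f I γ < g I γ) := by
  obtain ⟨a, ha⟩ := hg.sub hf
  exact ⟨.pos a, fun I γ => by
    have := ha I γ
    rw [Ctx.state] at this
    simp [Form.Holds, this]⟩

/-- Denominators are kept positive, so the sign of a fraction is the sign of its integer numerator,
which a machine test can see. -/
theorem DefProp.lt {f g : ∀ I, Γ.carrier I → ℝ} (hf : DefReal Γ f) (hg : DefReal Γ g) :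
    DefProp Γ (fun I γ => f I γ < g I γ) := by
  obtain ⟨a, b, h⟩ := hg.sub hf
  refine ⟨.pos a, fun I γ => ?_⟩
  obtain ⟨hb, hab⟩ := h I γ
  have hb' : (0 : ℝ) < (b.eval (Γ.state I γ) : ℝ) := by exact_mod_cast hb
  change 0 < a.eval (Γ.state I γ) ↔ _
  rw [← Int.cast_pos (R := ℝ), ← hab, mul_pos_iff_of_pos_right hb', sub_pos]

theorem DefProp.not {P : ∀ I, Γ.carrier I → Prop} (hP : DefProp Γ P) :
    DefProp Γ (fun I γ => ¬ P I γ) := by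
  obtain ⟨φ, hφ⟩ := hP
  exact ⟨.not φ, fun I γ => not_congr (hφ I γ)⟩

theorem DefProp.and {P R : ∀ I, Γ.carrier I → Prop} (hP : DefProp Γ P) (hR : DefProp Γ R) :
    DefProp Γ (fun I γ => P I γ ∧ R I γ) := by
  obtain ⟨φ, hφ⟩ := hP
  obtain ⟨ψ, hψ⟩ := hR
  exact ⟨.and φ ψ, fun I γ => and_congr (hφ I γ) (hψ I γ)⟩

theorem DefProp.or {P R : ∀ I, Γ.carrier I → Prop} (hP : DefProp Γ P) (hR : DefProp Γ R) :
    DefProp Γ (fun I γ => P I γ ∨ R I γ) :=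
  (hP.not.and hR.not).not.congr fun _ _ => by tauto

theorem DefProp.imp {P R : ∀ I, Γ.carrier I → Prop} (hP : DefProp Γ P) (hR : DefProp Γ R) :
    DefProp Γ (fun I γ => P I γ → R I γ) :=
  (hP.and hR.not).not.congr fun _ _ => by tauto

theorem DefProp.le {f g : ∀ I, Γ.carrier I → ℝ} (hf : DefReal Γ f) (hg : DefReal Γ g) :
    DefProp Γ (fun I γ => f I γ ≤ g I γ) :=
  (DefProp.lt hg hf).not.congr fun _ _ => not_lt

theorem DefProp.le_int {f g : ∀ I, Γ.carrier I → ℤ} (hf : DefInt Γ f) (hg : DefInt Γ g) :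
    DefProp Γ (fun I γ => f I γ ≤ g I γ) :=
  (DefProp.lt_int hg hf).not.congr fun _ _ => not_lt

theorem DefProp.true : DefProp Γ (fun _ _ => True) :=
  (DefProp.lt_int (.const 0) (.const 1)).congr fun _ _ => by simp

/-- The range has fixed size, so the quantifier is unrolled into a conjunction instead of a loop. -/
theorem DefProp.forall_fin {m : ℕ} {P : Fin m → ∀ I, Γ.carrier I → Prop}
    (hP : ∀ k, DefProp Γ (P k)) : DefProp Γ (fun I γ => ∀ k, P k I γ) := by
  induction m with
  | zero => exact DefProp.true.congr fun _ _ => by simp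
  | succ m ih =>
    exact ((hP 0).and (ih fun k => hP k.succ)).congr fun I γ =>
      (Fin.forall_fin_succ (P := fun k => P k I γ)).symm

/-- Cell `0` contains `I.n`, so the bounded quantifier of formulas runs exactly over the vertices.
-/
theorem DefProp.all {P : ∀ I, Γ.carrier I → Fin I.n → Prop}
    (hP : DefProp Γ.ext (fun I γ => P I γ.1 γ.2)) :
    DefProp Γ (fun I γ => ∀ v, P I γ v) := by
  obtain ⟨φ, hφ⟩ := hP
  refine ⟨.all φ, fun I γ => ⟨fun h v => ?_, fun h j h0 hj => ?_⟩⟩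
  · exact (hφ I (γ, v)).1 (h (v : ℕ) (by positivity) (by rw [I.memory_zero]; exact_mod_cast v.2))
  · rw [I.memory_zero] at hj
    obtain ⟨j, rfl⟩ := Int.eq_ofNat_of_zero_le h0
    exact (hφ I (γ, ⟨j, by exact_mod_cast hj⟩)).2 (h _)

section Vertices

variable {u v : ∀ I, Γ.carrier I → Fin I.n} (hu : IsVar Γ u) (hv : IsVar Γ v)
include hu

theorem DefReal.of_ratCell {q : ∀ I, Γ.carrier I → ℚ} {j : ℕ} (hj : j + 1 < 6)
    (h : ∀ I γ, (ratCode (I.x (I.G.cluster (u I γ))) ++ ratCode (I.y (I.G.cluster (u I γ))) ++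
      ratCode (I.len (I.G.cluster (u I γ)))).getD j 0 = (q I γ).num)
    (h' : ∀ I γ, (ratCode (I.x (I.G.cluster (u I γ))) ++ ratCode (I.y (I.G.cluster (u I γ))) ++
      ratCode (I.len (I.G.cluster (u I γ)))).getD (j + 1) 0 = (q I γ).den) :
    DefReal Γ (fun I γ => (q I γ : ℝ)) :=
  (DefReal.div_int ((DefInt.squareCell hu (Nat.lt_of_succ_lt hj)).congr h)
    ((DefInt.squareCell hu hj).congr h') fun I γ => by exact_mod_cast (q I γ).pos).congr
      fun I γ => by
        have := Rat.num_div_den (q I γ)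
        conv_rhs => rw [← this]
        push_cast
        rfl

theorem DefReal.square_x : DefReal Γ (fun I γ => (I.square (I.G.cluster (u I γ))).x) :=
  DefReal.of_ratCell (j := 0) hu (by norm_num) (fun _ _ => rfl) (fun _ _ => rfl)

theorem DefReal.square_y : DefReal Γ (fun I γ => (I.square (I.G.cluster (u I γ))).y) :=
  DefReal.of_ratCell (j := 2) hu (by norm_num) (fun _ _ => rfl) (fun _ _ => rfl)

theorem DefReal.square_len : DefReal Γ (fun I γ => (I.square (I.G.cluster (u I γ))).len) :=
  DefReal.of_ratCell (j := 4) hu (by norm_num) (fun _ _ => rfl) (fun _ _ => rfl)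

include hv

theorem DefProp.sameCluster :
    DefProp Γ (fun I γ => I.G.cluster (u I γ) = I.G.cluster (v I γ)) :=
  ((DefProp.le_int (.cluster hu) (.cluster hv)).and
    (DefProp.le_int (.cluster hv) (.cluster hu))).congr fun I γ => by
      rw [← le_antisymm_iff, Nat.cast_inj, Fin.val_inj]

theorem DefProp.adj : DefProp Γ (fun I γ => I.G.graph.Adj (u I γ) (v I γ)) :=
  (DefProp.lt_int (.const 0) ((((DefInt.const 2).add ((DefInt.const 6).mul .numClusters)).add
    ((DefInt.const 2).mul .numVertices)).add
      ((DefInt.numVertices.mul (.of_isVar hu)).add (.of_isVar hv))).memory).congr fun I γ => by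
        rw [I.memory_adj]
        split_ifs with h <;> simp [h]

theorem DefProp.inter : DefProp Γ (fun I γ => I.G.Inter (u I γ) (v I γ)) :=
  (DefProp.adj hu hv).and (DefProp.sameCluster hu hv).not

/-- Case distinction on the side that an edge is assigned to. -/
theorem DefReal.side {g : Side → ∀ I, Γ.carrier I → ℝ} (hg : ∀ s, DefReal Γ (g s)) :
    DefReal Γ (fun I γ => g (I.side (u I γ) (v I γ)) I γ) := by
  have hs := DefReal.of_int (DefInt.sideCode hu hv)
  have hc : ∀ z : ℤ, DefReal Γ
      (fun I γ => ((I.side (u I γ) (v I γ)).code : ℝ) - (z : ℝ)) := fun z => hs.sub (.const_int z)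
  have hr : DefReal Γ (fun _ _ => ((1 : ℤ) : ℝ) / ((6 : ℤ) : ℝ)) :=
    .div_int (.const 1) (.const 6) fun _ _ => by norm_num
  -- Lagrange interpolation at the codes `0, 1, 2, 3`. The products of differences at these nodes
  -- are `-6, 2, -2, 6`; the factors `-1, 3, -3, 1` and `1 / 6` normalise them.
  refine (hr.mul ((((((hc 1).mul (hc 2)).mul (hc 3)).mul ((DefReal.const_int (-1)).mul
    (hg .top))).add ((((hc 0).mul (hc 2)).mul (hc 3)).mul ((DefReal.const_int 3).mul
    (hg .bottom)))).add (((((hc 0).mul (hc 1)).mul (hc 3)).mul ((DefReal.const_int (-3)).mul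
    (hg .left))).add ((((hc 0).mul (hc 1)).mul (hc 2)).mul (hg .right))))).congr fun I γ => ?_
  cases I.side (u I γ) (v I γ) <;> simp [Side.code] <;> ring

end Vertices

end Closure

/-- A last vertex of a cluster tells the size of the cluster. -/
theorem Instance.pos_eq_ncard (I : Instance) {w : Fin I.n}
    (h : ∀ w', I.G.cluster w' = I.G.cluster w → I.order.pos w' ≤ I.order.pos w) :
    I.order.pos w = (I.G.verts (I.G.cluster w)).ncard := by
  have hb := I.order.bijOn (I.G.cluster w)
  have hw := hb.mapsTo (show w ∈ I.G.verts (I.G.cluster w) from rfl)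
  refine le_antisymm hw.2 ?_
  obtain ⟨w', hw', h'⟩ := hb.surjOn (show (I.G.verts (I.G.cluster w)).ncard ∈ Set.Icc 1 _ from
    ⟨hw.1.trans hw.2, le_rfl⟩)
  rw [← h']
  exact h w' hw'

theorem Instance.pos_pos (I : Instance) (w : Fin I.n) : 0 < I.order.pos w :=
  ((I.order.bijOn (I.G.cluster w)).mapsTo (show w ∈ I.G.verts (I.G.cluster w) from rfl)).1

theorem Instance.pos_le (I : Instance) (w : Fin I.n) :
    I.order.pos w ≤ (I.G.verts (I.G.cluster w)).ncard :=
  ((I.order.bijOn (I.G.cluster w)).mapsTo (show w ∈ I.G.verts (I.G.cluster w) from rfl)).2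

theorem Instance.exists_last (I : Instance) (u : Fin I.n) :
    ∃ w, I.G.cluster w = I.G.cluster u ∧
      ∀ w', I.G.cluster w' = I.G.cluster w → I.order.pos w' ≤ I.order.pos w := by
  obtain ⟨w, hw, h⟩ := (I.order.bijOn (I.G.cluster u)).surjOn
    (show (I.G.verts (I.G.cluster u)).ncard ∈ Set.Icc 1 _ from
      ⟨(I.pos_pos u).trans_le (I.pos_le u), le_rfl⟩)
  refine ⟨w, hw, fun w' hw' => ?_⟩
  have h1 := I.pos_le w'
  have h2 : I.G.cluster w = I.G.cluster u := hw
  rwa [hw', h2, ← h] at h1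

/-- The size of the cluster of a variable may be used in formulas. -/
theorem DefProp.size {Γ : Ctx} {u : ∀ I, Γ.carrier I → Fin I.n} (hu : IsVar Γ u)
    {P : ∀ I, Γ.carrier I → ℕ → Prop}
    (hP : DefProp Γ.ext (fun I γ => P I γ.1 (I.order.pos γ.2))) :
    DefProp Γ (fun I γ => P I γ (I.G.verts (I.G.cluster (u I γ))).ncard) := by
  -- Cluster sizes are not stored in the input. The size is the position of a last vertex `w` of the
  -- cluster; such a vertex exists, so quantifying universally over `w` suffices.
  refine (DefProp.all (P := fun I γ w => I.G.cluster w = I.G.cluster (u I γ) →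
    (∀ w', I.G.cluster w' = I.G.cluster w → I.order.pos w' ≤ I.order.pos w) →
      P I γ (I.order.pos w)) ((DefProp.sameCluster IsVar.last hu.weaken).imp (DefProp.imp
        (DefProp.all (P := fun I (γ : Γ.ext.carrier I) w' =>
          I.G.cluster w' = I.G.cluster γ.2 → I.order.pos w' ≤ I.order.pos γ.2)
          ((DefProp.sameCluster .last IsVar.last.weaken).imp ?_)) hP))).congr fun I γ => ?_
  · exact (DefProp.le_int (.pos .last) (.pos IsVar.last.weaken)).congr fun I γ => by
      exact Nat.cast_le
  · constructor
    · intro h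
      obtain ⟨w, hw, hlast⟩ := I.exists_last (u I γ)
      have := h w hw hlast
      rwa [I.pos_eq_ncard hlast, hw] at this
    · intro h w hw hlast
      rwa [I.pos_eq_ncard hlast, hw]

end NodeTrix

/-! ### Squares and pipes -/

namespace NodeTrix

/-- A separation of two squares by a horizontal or a vertical line. -/
def Square.Apart (Q R : Square) : Prop :=
  (Q.x + Q.len < R.x ∨ R.x + R.len < Q.x) ∨ Q.y + Q.len < R.y ∨ R.y + R.len < Q.y

/-- If both projections overlap, the lower left corner of the intersection is a common point. -/
theorem disjoint_region_iff (Q R : Square) : Disjoint Q.region R.region ↔ Q.Apart R := by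
  have hQ := Q.len_pos
  have hR := R.len_pos
  constructor
  · intro h
    by_contra hn
    simp only [Square.Apart, not_or, not_lt] at hn
    obtain ⟨⟨h1, h2⟩, h3, h4⟩ := hn
    refine Set.not_disjoint_iff.2 ⟨(max Q.x R.x, max Q.y R.y), ?_, ?_⟩ h
    · exact ⟨⟨le_max_left .., max_le (by linarith) h1⟩, le_max_left .., max_le (by linarith) h3⟩
    · exact ⟨⟨le_max_right .., max_le h2 (by linarith)⟩, le_max_right .., max_le h4 (by linarith)⟩
  · rintro h
    refine Set.disjoint_left.2 fun z hz hz' => ?_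
    obtain ⟨⟨h1, h2⟩, h3, h4⟩ := hz
    obtain ⟨⟨h5, h6⟩, h7, h8⟩ := hz'
    rcases h with (h | h) | h | h <;> linarith

/-- The four differences that are non-negative if and only if `S` and `Q` intersect. -/
def Square.gap (S : Square) : Fin 4 → Square → ℝ
  | 0, Q => S.x + S.len - Q.x
  | 1, Q => Q.x + Q.len - S.x
  | 2, Q => S.y + S.len - Q.y
  | 3, Q => Q.y + Q.len - S.y

/-- The condition for `S` to intersect the pipe of `Q` and `R`. -/
def Square.MeetsPipe (S Q R : Square) : Prop :=
  (∀ i, 0 ≤ S.gap i Q ∨ 0 ≤ S.gap i R) ∧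
    ∀ i j, S.gap i Q < 0 → S.gap j R < 0 → S.gap i Q * S.gap j R ≤ S.gap i R * S.gap j Q

/-- Finitely many affine functions on `[0, 1]`, given by their values at `0` and `1`, are
simultaneously non-negative somewhere if this holds for any two of them. -/
theorem exists_forall_nonneg {ι : Type*} [Finite ι] [Nonempty ι] (a b : ι → ℝ) :
    (∃ t ∈ Set.Icc (0 : ℝ) 1, ∀ i, 0 ≤ (1 - t) * a i + t * b i) ↔
      (∀ i, 0 ≤ a i ∨ 0 ≤ b i) ∧ ∀ i j, a i < 0 → b j < 0 → a i * b j ≤ b i * a j := by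
  constructor
  · rintro ⟨t, ⟨h0, h1⟩, h⟩
    have key : ∀ i, 0 ≤ a i ∨ 0 ≤ b i := by
      intro i
      by_contra hn
      simp only [not_or, not_le] at hn
      have := h i
      rcases h0.eq_or_lt with rfl | h0
      · nlinarith
      · nlinarith [mul_neg_of_pos_of_neg h0 hn.2,
          mul_nonpos_of_nonneg_of_nonpos (sub_nonneg.2 h1) hn.1.le]
    refine ⟨key, fun i j hi hj => ?_⟩
    have hbi := (key i).resolve_left hi.not_ge
    have haj := (key j).resolve_right hj.not_ge
    have h2 := h i
    have h3 := h j
    have ht : 0 < t := by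
      rcases h0.eq_or_lt with rfl | h0
      · linarith
      · exact h0
    -- The product of the two inequalities at `t`; the factor `(1 - t) * t` is then cancelled.
    have h4 : (1 - t) * (-a i) * (t * (-b j)) ≤ (t * b i) * ((1 - t) * a j) :=
      mul_le_mul (by linarith) (by linarith) (mul_nonneg ht.le (by linarith))
        (mul_nonneg ht.le hbi)
    rcases h1.eq_or_lt with rfl | h1
    · linarith
    · have : 0 < (1 - t) * t := mul_pos (by linarith) ht
      nlinarith
  · classical
    rintro ⟨h1, h2⟩
    -- `lo i` is the left end of the interval on which the `i`-th function is non-negative, its zero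
    -- if it starts negative. The largest of these left ends is the common point.
    set lo : ι → ℝ := fun i => if a i < 0 then a i / (a i - b i) else 0 with hlo
    obtain ⟨k, hk⟩ := Finite.exists_max lo
    have hlo0 : ∀ i, 0 ≤ lo i := fun i => by
      simp only [hlo]
      split_ifs with h
      · have := (h1 i).resolve_left h.not_ge
        exact div_nonneg_of_nonpos h.le (by linarith)
      · exact le_rfl
    have hlo1 : ∀ i, lo i ≤ 1 := fun i => by
      simp only [hlo]
      split_ifs with h
      · have := (h1 i).resolve_left h.not_ge
        rw [div_le_one_of_neg (by linarith)]
        linarith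
      · norm_num
    refine ⟨lo k, ⟨hlo0 k, hlo1 k⟩, fun j => ?_⟩
    have hk0 := hlo0 k
    have hk1 := hlo1 k
    rcases lt_or_ge (a j) 0 with haj | haj
    · have hbj := (h1 j).resolve_left haj.not_ge
      have hj := hk j
      have h3 : lo j * (a j - b j) = a j := by
        simp only [hlo, haj, if_true]
        exact div_mul_cancel₀ _ (by linarith)
      nlinarith
    · rcases lt_or_ge (b j) 0 with hbj | hbj
      · by_cases hak : a k < 0
        · have hbk := (h1 k).resolve_left hak.not_ge
          have h3 := h2 k j hak hbj
          have h4 : lo k = a k / (a k - b k) := by simp only [hlo, hak, if_true]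
          have h5 : a k - b k < 0 := by linarith
          have h6 : (1 - lo k) * a j + lo k * b j = (a k * b j - b k * a j) / (a k - b k) := by
            rw [h4, eq_div_iff h5.ne]
            have := div_mul_cancel₀ (a k) h5.ne
            linear_combination (b j - a j) * this
          rw [h6]
          exact div_nonneg_of_nonpos (by linarith) h5.le
        · have : lo k = 0 := by simp only [hlo, hak, if_false]
          rw [this]; linarith
      · exact add_nonneg (mul_nonneg (by linarith) haj) (mul_nonneg hk0 hbj)

theorem Square.convex_region (Q : Square) : Convex ℝ Q.region :=
  (convex_Icc _ _).prod (convex_Icc _ _)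

theorem Square.nonempty_region (Q : Square) : Q.region.Nonempty :=
  ⟨(Q.x, Q.y), ⟨le_rfl, by linarith [Q.len_pos]⟩, le_rfl, by linarith [Q.len_pos]⟩

/-- The pipe is swept by the squares that interpolate linearly between `Q` and `R`. Conversely, a
point with relative coordinates `α`, `β` in an interpolated square is the combination of the points
of `Q` and `R` with the same relative coordinates. -/
theorem mem_pipe_iff (Q R : Square) (z : ℝ × ℝ) : z ∈ pipe Q R ↔ ∃ t ∈ Set.Icc (0 : ℝ) 1,
    ((1 - t) * Q.x + t * R.x ≤ z.1 ∧ z.1 ≤ (1 - t) * (Q.x + Q.len) + t * (R.x + R.len)) ∧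
    ((1 - t) * Q.y + t * R.y ≤ z.2 ∧ z.2 ≤ (1 - t) * (Q.y + Q.len) + t * (R.y + R.len)) := by
  have hQ := Q.len_pos
  have hR := R.len_pos
  rw [pipe, Q.convex_region.convexHull_union R.convex_region Q.nonempty_region R.nonempty_region,
    mem_convexJoin]
  constructor
  · rintro ⟨a, ⟨⟨h1, h2⟩, h3, h4⟩, b, ⟨⟨h5, h6⟩, h7, h8⟩, s, t, hs, ht, hst, rfl⟩
    obtain rfl : s = 1 - t := by linarith
    refine ⟨t, ⟨ht, by linarith⟩, ⟨?_, ?_⟩, ?_, ?_⟩ <;>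
      simp only [Prod.fst_add, Prod.snd_add, Prod.smul_fst, Prod.smul_snd, smul_eq_mul] <;>
      exact add_le_add (mul_le_mul_of_nonneg_left (by assumption) hs)
        (mul_le_mul_of_nonneg_left (by assumption) ht)
  · rintro ⟨t, ⟨h0, h1⟩, ⟨h2, h3⟩, h4, h5⟩
    have hl : 0 < (1 - t) * Q.len + t * R.len := by
      rcases h0.eq_or_lt with rfl | h0
      · linarith
      · exact add_pos_of_nonneg_of_pos (mul_nonneg (by linarith) hQ.le) (mul_pos h0 hR)
    set l := (1 - t) * Q.len + t * R.len with hldef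
    set α := (z.1 - ((1 - t) * Q.x + t * R.x)) / l with hα
    set β := (z.2 - ((1 - t) * Q.y + t * R.y)) / l with hβ
    have hα0 : 0 ≤ α := div_nonneg (by linarith) hl.le
    have hβ0 : 0 ≤ β := div_nonneg (by linarith) hl.le
    have hα1 : α ≤ 1 := by rw [hα, div_le_one hl]; linarith
    have hβ1 : β ≤ 1 := by rw [hβ, div_le_one hl]; linarith
    have hαl : α * l = z.1 - ((1 - t) * Q.x + t * R.x) := div_mul_cancel₀ _ hl.ne'
    have hβl : β * l = z.2 - ((1 - t) * Q.y + t * R.y) := div_mul_cancel₀ _ hl.ne'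
    refine ⟨(Q.x + α * Q.len, Q.y + β * Q.len), ⟨⟨?_, ?_⟩, ?_, ?_⟩,
      (R.x + α * R.len, R.y + β * R.len), ⟨⟨?_, ?_⟩, ?_, ?_⟩, 1 - t, t, by linarith, h0,
      by linarith, Prod.ext ?_ ?_⟩
    all_goals try (simp only; nlinarith)
    · simp only [Prod.fst_add, Prod.smul_fst, smul_eq_mul]
      linear_combination hαl + α * hldef
    · simp only [Prod.snd_add, Prod.smul_snd, smul_eq_mul]
      linear_combination hβl + β * hldef

theorem disjoint_pipe_iff (Q R S : Square) : Disjoint (pipe Q R) S.region ↔ ¬ S.MeetsPipe Q R := by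
  have hQ := Q.len_pos
  have hR := R.len_pos
  have hS := S.len_pos
  -- Gaps are affine under interpolation: `(1 - t) * S.gap i Q + t * S.gap i R` is the `i`-th gap
  -- between `S` and the interpolated square.
  rw [Square.MeetsPipe, ← exists_forall_nonneg, ← not_iff_not, not_not,
    Set.not_disjoint_iff, iff_comm]
  constructor
  · rintro ⟨t, ht, h⟩
    obtain ⟨h0, h1⟩ := ht
    have h2 := h 0
    have h3 := h 1
    have h4 := h 2
    have h5 := h 3
    simp only [Square.gap] at h2 h3 h4 h5
    have hl : 0 ≤ (1 - t) * Q.len + t * R.len :=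
      add_nonneg (mul_nonneg (by linarith) hQ.le) (mul_nonneg h0 hR.le)
    refine ⟨(max ((1 - t) * Q.x + t * R.x) S.x, max ((1 - t) * Q.y + t * R.y) S.y),
      (mem_pipe_iff ..).2 ⟨t, ⟨h0, h1⟩, ⟨le_max_left .., max_le ?_ ?_⟩, le_max_left ..,
        max_le ?_ ?_⟩, ⟨le_max_right .., max_le ?_ ?_⟩, le_max_right .., max_le ?_ ?_⟩ <;> linarith
  · rintro ⟨z, hz, ⟨h2, h3⟩, h4, h5⟩
    obtain ⟨t, ht, ⟨h6, h7⟩, h8, h9⟩ := (mem_pipe_iff ..).1 hz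
    refine ⟨t, ht, fun i => ?_⟩
    fin_cases i <;> simp only [Square.gap] <;> linarith

/-! ### Incidence points and the outward side of a square. -/

/-- How far `z` lies, seen from `p`, in the outward direction of a side. -/
def Side.outset : Side → ℝ × ℝ → ℝ × ℝ → ℝ
  | .top, p, z => z.2 - p.2
  | .bottom, p, z => p.2 - z.2
  | .left, p, z => p.1 - z.1
  | .right, p, z => z.1 - p.1

/-- `p` lies on the line through a side of `Q` and `q` lies beyond this line. -/
def Square.Outward (Q : Square) (p q : ℝ × ℝ) : Prop :=
  ((p.1 = Q.x ∧ q.1 < p.1) ∨ (p.1 = Q.x + Q.len ∧ p.1 < q.1)) ∨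
    (p.2 = Q.y ∧ q.2 < p.2) ∨ (p.2 = Q.y + Q.len ∧ p.2 < q.2)

/-- Strictness keeps incidence points away from the corners, so that near such a point the square
looks like a half-plane. -/
theorem ratio_mem_Ioo {n j : ℕ} (h1 : 1 ≤ j) (hn : j ≤ n) :
    0 < ((j : ℝ) - 1 / 2) / n ∧ ((j : ℝ) - 1 / 2) / n < 1 := by
  have h1' : (1 : ℝ) ≤ j := by exact_mod_cast h1
  have hn' : (j : ℝ) ≤ n := by exact_mod_cast hn
  exact ⟨div_pos (by linarith) (by linarith), (div_lt_one (by linarith)).2 (by linarith)⟩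

section Midpoint

variable (Q : Square) {n j : ℕ} (h1 : 1 ≤ j) (hn : j ≤ n) (s : Side)
include h1 hn

theorem Square.midpoint_mem_region : Q.midpoint n j s ∈ Q.region := by
  have hl := Q.len_pos
  obtain ⟨h2, h3⟩ := ratio_mem_Ioo h1 hn
  generalize hθ : ((j : ℝ) - 1 / 2) / n = θ at h2 h3
  cases s <;> simp only [Square.midpoint, hθ] <;> refine ⟨⟨?_, ?_⟩, ?_, ?_⟩ <;> simp only <;>
    nlinarith

omit h1 hn in
theorem Square.outward_midpoint {q : ℝ × ℝ} (h : 0 < s.outset (Q.midpoint n j s) q) :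
    Q.Outward (Q.midpoint n j s) q := by
  cases s <;> simp only [Side.outset, Square.midpoint, sub_pos] at h <;>
    simp [Square.Outward, Square.midpoint, h]

/-- Opposite sides are disjoint and adjacent ones meet only in corners, which are no mid-points; on
one side the ratio determines the position. -/
theorem Square.midpoint_injective {j' : ℕ} (h1' : 1 ≤ j') (hn' : j' ≤ n) {s' : Side}
    (h : Q.midpoint n j s = Q.midpoint n j' s') : j = j' := by
  have hl := Q.len_pos
  have hn0 : (n : ℝ) ≠ 0 := by
    have : 0 < n := by omega
    exact_mod_cast this.ne'
  have key : ((j : ℝ) - 1 / 2) / n = ((j' : ℝ) - 1 / 2) / n → j = j' := fun h => by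
    field_simp at h
    have : (j : ℝ) = j' := by linarith
    exact_mod_cast this
  apply key
  obtain ⟨h2, h3⟩ := ratio_mem_Ioo h1 hn
  obtain ⟨h2', h3'⟩ := ratio_mem_Ioo h1' hn'
  have h4 := mul_pos hl h2
  have h5 := mul_lt_mul_of_pos_left h3 hl
  have h4' := mul_pos hl h2'
  have h5' := mul_lt_mul_of_pos_left h3' hl
  cases s <;> cases s' <;> simp only [Square.midpoint, Prod.mk.injEq] at h <;>
    obtain ⟨ha, hb⟩ := h <;>
    exact mul_left_cancel₀ hl.ne' (by linarith)

/-- Close to the mid-point of a segment of a side, only this side bounds the square. -/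
theorem Square.eventually_mem_region : ∀ᶠ z in nhds (Q.midpoint n j s),
    s.outset (Q.midpoint n j s) z ≤ 0 → z ∈ Q.region := by
  have hl := Q.len_pos
  obtain ⟨h2, h3⟩ := ratio_mem_Ioo h1 hn
  have h2' := mul_pos hl h2
  have h3' := mul_lt_mul_of_pos_left h3 hl
  have hx : ∀ {p : ℝ × ℝ} {c : ℝ}, c < p.1 → ∀ᶠ z in nhds p, c < z.1 := fun h =>
    Filter.Tendsto.eventually_const_lt h continuousAt_fst
  have hx' : ∀ {p : ℝ × ℝ} {c : ℝ}, p.1 < c → ∀ᶠ z in nhds p, z.1 < c := fun h =>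
    Filter.Tendsto.eventually_lt_const h continuousAt_fst
  have hy : ∀ {p : ℝ × ℝ} {c : ℝ}, c < p.2 → ∀ᶠ z in nhds p, c < z.2 := fun h =>
    Filter.Tendsto.eventually_const_lt h continuousAt_snd
  have hy' : ∀ {p : ℝ × ℝ} {c : ℝ}, p.2 < c → ∀ᶠ z in nhds p, z.2 < c := fun h =>
    Filter.Tendsto.eventually_lt_const h continuousAt_snd
  cases s <;> simp only [Square.midpoint, Side.outset]
  · filter_upwards [hx (c := Q.x) (by simp only; linarith),
      hx' (c := Q.x + Q.len) (by simp only; linarith),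
      hy (c := Q.y) (by simp only; linarith)] with z h4 h5 h6 h7
    exact ⟨⟨h4.le, h5.le⟩, h6.le, by linarith⟩
  · filter_upwards [hx (c := Q.x) (by simp only; linarith),
      hx' (c := Q.x + Q.len) (by simp only; linarith),
      hy' (c := Q.y + Q.len) (by simp only; linarith)] with z h4 h5 h6 h7
    exact ⟨⟨h4.le, h5.le⟩, by linarith, h6.le⟩
  · filter_upwards [hx' (c := Q.x + Q.len) (by simp only; linarith),
      hy (c := Q.y) (by simp only; linarith),
      hy' (c := Q.y + Q.len) (by simp only; linarith)] with z h4 h5 h6 h7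
    exact ⟨⟨by linarith, h4.le⟩, h5.le, h6.le⟩
  · filter_upwards [hx (c := Q.x) (by simp only; linarith),
      hy (c := Q.y) (by simp only; linarith),
      hy' (c := Q.y + Q.len) (by simp only; linarith)] with z h4 h5 h6 h7
    exact ⟨⟨h4.le, by linarith⟩, h5.le, h6.le⟩

end Midpoint

/-- Applied to the coordinate across a side: points on or beyond the line of the side average to a
point not beyond it only if those with positive weight lie on the line. -/
theorem convex_combination_extremal {a b c s t : ℝ} (hs : 0 ≤ s) (ht : 0 ≤ t) (hst : s + t = 1)
    (ha : a ≤ c) (hb : b ≤ c) (h : c ≤ s * a + t * b) :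
    (a = c ∧ b = c) ∨ (a = c ∧ t = 0) ∨ b = c ∧ s = 0 := by
  rcases hs.eq_or_lt with rfl | hs
  · obtain rfl : t = 1 := by linarith
    exact .inr (.inr ⟨by linarith, rfl⟩)
  · have hc : c = s * c + t * c := by rw [← add_mul, hst, one_mul]
    have hac : a = c := by
      by_contra hne
      linarith [mul_lt_mul_of_pos_left (lt_of_le_of_ne ha hne) hs, mul_le_mul_of_nonneg_left hb ht]
    rcases ht.eq_or_lt with rfl | ht
    · exact .inr (.inl ⟨hac, rfl⟩)
    · refine .inl ⟨hac, ?_⟩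
      by_contra hne
      linarith [mul_lt_mul_of_pos_left (lt_of_le_of_ne hb hne) ht,
        mul_le_mul_of_nonneg_left ha hs.le]

/-- Among the points of a segment with end-points beyond a side of a square, only a starting point
on this side can belong to the square. -/
theorem Square.Outward.eq_of_mem_segment {Q : Square} {p q a b z : ℝ × ℝ} (h : Q.Outward p q)
    (ha1 : a.1 ∈ Set.uIcc p.1 q.1) (ha2 : a.2 ∈ Set.uIcc p.2 q.2)
    (hap1 : p.1 ≠ q.1 → a.1 = p.1 → a = p) (hap2 : p.2 ≠ q.2 → a.2 = p.2 → a = p)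
    (hb1 : b.1 ∈ Set.uIcc p.1 q.1) (hb2 : b.2 ∈ Set.uIcc p.2 q.2)
    (hbp1 : p.1 ≠ q.1 → b.1 = p.1 → b = p) (hbp2 : p.2 ≠ q.2 → b.2 = p.2 → b = p)
    (hz : z ∈ segment ℝ a b) (hzQ : z ∈ Q.region) : z = p := by
  obtain ⟨s, t, hs, ht, hst, rfl⟩ := hz
  obtain ⟨⟨h1, h2⟩, h3, h4⟩ := hzQ
  simp only [Prod.fst_add, Prod.snd_add, Prod.smul_fst, Prod.smul_snd, smul_eq_mul] at h1 h2 h3 h4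
  have key : (a = p ∧ b = p) ∨ (a = p ∧ t = 0) ∨ (b = p ∧ s = 0) → s • a + t • b = p := by
    rintro (⟨rfl, rfl⟩ | ⟨rfl, rfl⟩ | ⟨rfl, rfl⟩)
    · rw [← add_smul, hst, one_smul]
    · simp [show s = 1 by linarith]
    · simp [show t = 1 by linarith]
  apply key
  rcases h with (⟨hp, hq⟩ | ⟨hp, hq⟩) | ⟨hp, hq⟩ | ⟨hp, hq⟩
  · rw [Set.uIcc_of_ge hq.le] at ha1 hb1
    have ha := hap1 hq.ne'
    have hb := hbp1 hq.ne'
    rcases convex_combination_extremal hs ht hst ha1.2 hb1.2 (by linarith) with h | h | h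
    exacts [.inl ⟨ha h.1, hb h.2⟩, .inr (.inl ⟨ha h.1, h.2⟩), .inr (.inr ⟨hb h.1, h.2⟩)]
  · rw [Set.uIcc_of_le hq.le] at ha1 hb1
    have ha := hap1 hq.ne
    have hb := hbp1 hq.ne
    rcases convex_combination_extremal hs ht hst (neg_le_neg ha1.1) (neg_le_neg hb1.1)
      (by linarith) with h | h | h
    all_goals simp only [neg_inj] at h
    exacts [.inl ⟨ha h.1, hb h.2⟩, .inr (.inl ⟨ha h.1, h.2⟩), .inr (.inr ⟨hb h.1, h.2⟩)]
  · rw [Set.uIcc_of_ge hq.le] at ha2 hb2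
    have ha := hap2 hq.ne'
    have hb := hbp2 hq.ne'
    rcases convex_combination_extremal hs ht hst ha2.2 hb2.2 (by linarith) with h | h | h
    exacts [.inl ⟨ha h.1, hb h.2⟩, .inr (.inl ⟨ha h.1, h.2⟩), .inr (.inr ⟨hb h.1, h.2⟩)]
  · rw [Set.uIcc_of_le hq.le] at ha2 hb2
    have ha := hap2 hq.ne
    have hb := hbp2 hq.ne
    rcases convex_combination_extremal hs ht hst (neg_le_neg ha2.1) (neg_le_neg hb2.1)
      (by linarith) with h | h | h
    all_goals simp only [neg_inj] at h
    exacts [.inl ⟨ha h.1, hb h.2⟩, .inr (.inl ⟨ha h.1, h.2⟩), .inr (.inr ⟨hb h.1, h.2⟩)]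

end NodeTrix

/-! ### Monotone paths -/

namespace NodeTrix

/-- A path from `p` to `q` each of whose coordinates is injective or constant. -/
structure MonoPath (f : ℝ → ℝ × ℝ) (p q : ℝ × ℝ) : Prop where
  continuousOn : ContinuousOn f (Set.Icc 0 1)
  source : f 0 = p
  target : f 1 = q
  injOn_fst : p.1 ≠ q.1 → Set.InjOn (fun t => (f t).1) (Set.Icc 0 1)
  injOn_snd : p.2 ≠ q.2 → Set.InjOn (fun t => (f t).2) (Set.Icc 0 1)
  fst_eq : p.1 = q.1 → ∀ t ∈ Set.Icc (0 : ℝ) 1, (f t).1 = p.1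
  snd_eq : p.2 = q.2 → ∀ t ∈ Set.Icc (0 : ℝ) 1, (f t).2 = p.2

theorem zero_mem_Icc : (0 : ℝ) ∈ Set.Icc (0 : ℝ) 1 := ⟨le_rfl, zero_le_one⟩

theorem one_mem_Icc : (1 : ℝ) ∈ Set.Icc (0 : ℝ) 1 := ⟨zero_le_one, le_rfl⟩

theorem fst_eq_of_mem_segment {a b z : ℝ × ℝ} (h : a.1 = b.1) (hz : z ∈ segment ℝ a b) :
    z.1 = a.1 := by
  obtain ⟨s, t, _, _, hst, rfl⟩ := hz
  simp only [Prod.fst_add, Prod.smul_fst, smul_eq_mul]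
  rw [← h, ← add_mul, hst, one_mul]

theorem snd_eq_of_mem_segment {a b z : ℝ × ℝ} (h : a.2 = b.2) (hz : z ∈ segment ℝ a b) :
    z.2 = a.2 := by
  obtain ⟨s, t, _, _, hst, rfl⟩ := hz
  simp only [Prod.snd_add, Prod.smul_snd, smul_eq_mul]
  rw [← h, ← add_mul, hst, one_mul]

/-- An `xy`-monotone arc is the image of a monotone path. -/
theorem IsArc.exists_monoPath {A : Set (ℝ × ℝ)} {p q : ℝ × ℝ} (h : IsArc A p q)
    (hA : IsXYMonotone A) : ∃ f, MonoPath f p q ∧ f '' Set.Icc 0 1 = A := by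
  obtain ⟨f, hc, hi, rfl, rfl, rfl⟩ := h
  have hne : f 0 ≠ f 1 := fun h => zero_ne_one (hi zero_mem_Icc one_mem_Icc h)
  refine ⟨f, ?_, rfl⟩
  have hmem : ∀ t ∈ Set.Icc (0 : ℝ) 1, f t ∈ f '' Set.Icc 0 1 := fun t ht => ⟨t, ht, rfl⟩
  rcases hA with ⟨a, b, hab, hA⟩ | ⟨h1, h2⟩
  · rw [hA] at hmem
    rcases hab with hab | hab
    -- On an axis-parallel segment one coordinate is constant, so injectivity of the arc passes to
    -- the other one.
    · have hf : ∀ t ∈ Set.Icc (0 : ℝ) 1, ∀ s ∈ Set.Icc (0 : ℝ) 1, (f t).1 = (f s).1 :=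
        fun t ht s hs => (fst_eq_of_mem_segment hab (hmem t ht)).trans
          (fst_eq_of_mem_segment hab (hmem s hs)).symm
      have h01 := hf 0 zero_mem_Icc 1 one_mem_Icc
      exact ⟨hc, rfl, rfl, fun h => (h h01).elim,
        fun _ t ht s hs h => hi ht hs (Prod.ext (hf t ht s hs) h),
        fun _ t ht => hf t ht 0 zero_mem_Icc, fun h => (hne (Prod.ext h01 h)).elim⟩
    · have hf : ∀ t ∈ Set.Icc (0 : ℝ) 1, ∀ s ∈ Set.Icc (0 : ℝ) 1, (f t).2 = (f s).2 :=
        fun t ht s hs => (snd_eq_of_mem_segment hab (hmem t ht)).trans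
          (snd_eq_of_mem_segment hab (hmem s hs)).symm
      have h01 := hf 0 zero_mem_Icc 1 one_mem_Icc
      exact ⟨hc, rfl, rfl, fun _ t ht s hs h => hi ht hs (Prod.ext h (hf t ht s hs)),
        fun h => (h h01).elim, fun h => (hne (Prod.ext h h01)).elim,
        fun _ t ht => hf t ht 0 zero_mem_Icc⟩
  · have h0 := hmem 0 zero_mem_Icc
    have h1' := hmem 1 one_mem_Icc
    exact ⟨hc, rfl, rfl, fun _ t ht s hs h => hi ht hs (h1 (hmem t ht) (hmem s hs) h),
      fun _ t ht s hs h => hi ht hs (h2 (hmem t ht) (hmem s hs) h),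
      fun h => (hne (h1 h0 h1' h)).elim, fun h => (hne (h2 h0 h1' h)).elim⟩

/-- A continuous injective function on an interval is strictly monotone. -/
theorem mem_uIcc_of_injOn {g : ℝ → ℝ} (hc : ContinuousOn g (Set.Icc 0 1))
    (hi : Set.InjOn g (Set.Icc 0 1)) {t : ℝ} (ht : t ∈ Set.Icc (0 : ℝ) 1) :
    g t ∈ Set.uIcc (g 0) (g 1) := by
  rcases hc.strictMonoOn_of_injOn_Icc' zero_le_one hi with h | h
  · exact Set.mem_uIcc_of_le (h.monotoneOn zero_mem_Icc ht ht.1)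
      (h.monotoneOn ht one_mem_Icc ht.2)
  · exact Set.mem_uIcc_of_ge (h.antitoneOn ht one_mem_Icc ht.2)
      (h.antitoneOn zero_mem_Icc ht ht.1)

/-- A continuous injective coordinate may be used as the parameter of a curve. -/
theorem exists_graph {X Y : ℝ → ℝ} (hX : ContinuousOn X (Set.Icc 0 1))
    (hY : ContinuousOn Y (Set.Icc 0 1)) (hi : Set.InjOn X (Set.Icc 0 1)) :
    ∃ E : ℝ → ℝ, ContinuousOn E (Set.uIcc (X 0) (X 1)) ∧
      ∀ t ∈ Set.Icc (0 : ℝ) 1, E (X t) = Y t := by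
  let g : Set.Icc (0 : ℝ) 1 → ℝ := fun t => X t
  have hg : Continuous g := continuousOn_iff_continuous_domRestrict.1 hX
  have hgi : Function.Injective g := fun s t h => Subtype.ext (hi s.2 t.2 h)
  -- By compactness `X` is a homeomorphism onto its range, so `E`, which is `Y` after the inverse of
  -- `X`, is continuous there; its value `0` elsewhere plays no role.
  have hemb := hg.isClosedEmbedding hgi
  let h := hemb.isEmbedding.toHomeomorph
  let E := Function.extend g (fun t => Y t) 0
  have hE : ∀ t, E (g t) = Y t := fun t => hgi.extend_apply _ _ _
  refine ⟨E, ?_, fun t ht => hE ⟨t, ht⟩⟩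
  have hr : ContinuousOn E (Set.range g) := by
    rw [continuousOn_iff_continuous_domRestrict, ← h.comp_continuous_iff']
    have : (Set.range g).domRestrict E ∘ h = fun t : Set.Icc (0 : ℝ) 1 => Y t :=
      funext fun t => hE t
    rw [this]
    exact continuousOn_iff_continuous_domRestrict.1 hY
  refine hr.mono fun x hx => ?_
  obtain ⟨t, ht, rfl⟩ := hX.surjOn_uIcc zero_mem_Icc one_mem_Icc hx
  exact ⟨⟨t, ht⟩, rfl⟩

theorem swap_mem_segment {a b z : ℝ × ℝ} (hz : z ∈ segment ℝ a b) :
    z.swap ∈ segment ℝ a.swap b.swap := by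
  obtain ⟨s, t, hs, ht, hst, rfl⟩ := hz
  exact ⟨s, t, hs, ht, hst, rfl⟩

namespace MonoPath

variable {f g : ℝ → ℝ × ℝ} {p q p' q' : ℝ × ℝ}

theorem swap (h : MonoPath f p q) : MonoPath (fun t => (f t).swap) p.swap q.swap where
  continuousOn := continuous_swap.comp_continuousOn h.continuousOn
  source := by simp [h.source]
  target := by simp [h.target]
  injOn_fst := h.injOn_snd
  injOn_snd := h.injOn_fst
  fst_eq := h.snd_eq
  snd_eq := h.fst_eq

theorem continuousOn_fst (h : MonoPath f p q) : ContinuousOn (fun t => (f t).1) (Set.Icc 0 1) :=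
  continuous_fst.comp_continuousOn h.continuousOn

theorem continuousOn_snd (h : MonoPath f p q) : ContinuousOn (fun t => (f t).2) (Set.Icc 0 1) :=
  continuous_snd.comp_continuousOn h.continuousOn

theorem fst_mem (h : MonoPath f p q) {t : ℝ} (ht : t ∈ Set.Icc (0 : ℝ) 1) :
    (f t).1 ∈ Set.uIcc p.1 q.1 := by
  by_cases hpq : p.1 = q.1
  · rw [h.fst_eq hpq t ht]; exact Set.left_mem_uIcc
  · have := mem_uIcc_of_injOn h.continuousOn_fst (h.injOn_fst hpq) ht
    rwa [h.source, h.target] at this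

theorem snd_mem (h : MonoPath f p q) {t : ℝ} (ht : t ∈ Set.Icc (0 : ℝ) 1) :
    (f t).2 ∈ Set.uIcc p.2 q.2 :=
  h.swap.fst_mem ht

theorem eq_source_of_fst (h : MonoPath f p q) {t : ℝ} (ht : t ∈ Set.Icc (0 : ℝ) 1)
    (hpq : p.1 ≠ q.1) (hf : (f t).1 = p.1) : f t = p := by
  have : t = 0 := h.injOn_fst hpq ht zero_mem_Icc (by simp only; rw [hf, h.source])
  rw [this, h.source]

theorem eq_source_of_snd (h : MonoPath f p q) {t : ℝ} (ht : t ∈ Set.Icc (0 : ℝ) 1)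
    (hpq : p.2 ≠ q.2) (hf : (f t).2 = p.2) : f t = p := by
  have : t = 0 := h.injOn_snd hpq ht zero_mem_Icc (by simp only; rw [hf, h.source])
  rw [this, h.source]

theorem reverse (h : MonoPath f p q) : MonoPath (fun t => f (1 - t)) q p := by
  have hm : Set.MapsTo (fun t : ℝ => 1 - t) (Set.Icc 0 1) (Set.Icc 0 1) :=
    fun t ht => ⟨by linarith [ht.2], by linarith [ht.1]⟩
  have hi : Set.InjOn (fun t : ℝ => 1 - t) (Set.Icc 0 1) := fun s _ t _ h => by
    simp only at h; linarith
  exact ⟨h.continuousOn.comp (by fun_prop) hm, by simp [h.target], by simp [h.source],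
    fun hpq => (h.injOn_fst hpq.symm).comp hi hm, fun hpq => (h.injOn_snd hpq.symm).comp hi hm,
    fun hpq t ht => (h.fst_eq hpq.symm _ (hm ht)).trans hpq.symm,
    fun hpq t ht => (h.snd_eq hpq.symm _ (hm ht)).trans hpq.symm⟩

/-- The straight path. -/
theorem lineMap (p q : ℝ × ℝ) : MonoPath (AffineMap.lineMap p q) p q := by
  refine ⟨AffineMap.lineMap_continuous.continuousOn, by simp, by simp, fun h s _ t _ hst => ?_,
    fun h s _ t _ hst => ?_, fun h t _ => ?_, fun h t _ => ?_⟩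
  · have : (s - t) * (q.1 - p.1) = 0 := by
      simp [AffineMap.lineMap_apply] at hst
      rcases hst with rfl | hst
      · simp
      · rw [hst, mul_zero]
    rcases mul_eq_zero.1 this with h' | h'
    · linarith
    · exact (h (by linarith)).elim
  · have : (s - t) * (q.2 - p.2) = 0 := by
      simp [AffineMap.lineMap_apply] at hst
      rcases hst with rfl | hst
      · simp
      · rw [hst, mul_zero]
    rcases mul_eq_zero.1 this with h' | h'
    · linarith
    · exact (h (by linarith)).elim
  · simp [AffineMap.lineMap_apply, h]
  · simp [AffineMap.lineMap_apply, h]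

theorem injOn (h : MonoPath f p q) (hpq : p ≠ q) : Set.InjOn f (Set.Icc 0 1) := by
  intro s hs t ht hst
  by_cases h1 : p.1 = q.1
  · exact h.injOn_snd (fun h2 => hpq (Prod.ext h1 h2)) hs ht (congrArg Prod.snd hst)
  · exact h.injOn_fst h1 hs ht (congrArg Prod.fst hst)

/-- One coordinate is constant and the other takes all intermediate values, so the path covers the
whole axis-parallel segment. -/
theorem exists_eq_of_mem_segment (h : MonoPath f p q) {w : ℝ × ℝ} (hw : w ∈ segment ℝ p q)
    (hpq : p.1 = q.1 ∨ p.2 = q.2) : ∃ t ∈ Set.Icc (0 : ℝ) 1, f t = w := by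
  have hw' := hw
  rw [segment_eq_image_lineMap] at hw'
  obtain ⟨θ, hθ, rfl⟩ := hw'
  rcases hpq with hpq | hpq
  · have := (lineMap p q).snd_mem hθ
    rw [← h.source, ← h.target] at this
    obtain ⟨t, ht, hft⟩ := h.continuousOn_snd.surjOn_uIcc zero_mem_Icc one_mem_Icc this
    rw [h.source, h.target] at hft
    exact ⟨t, ht, Prod.ext ((h.fst_eq hpq t ht).trans (fst_eq_of_mem_segment hpq hw).symm) hft⟩
  · have := (lineMap p q).fst_mem hθ
    rw [← h.source, ← h.target] at this
    obtain ⟨t, ht, hft⟩ := h.continuousOn_fst.surjOn_uIcc zero_mem_Icc one_mem_Icc this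
    rw [h.source, h.target] at hft
    exact ⟨t, ht, Prod.ext hft ((h.snd_eq hpq t ht).trans (snd_eq_of_mem_segment hpq hw).symm)⟩

end MonoPath

/-! ### Straightening two monotone paths without losing a crossing. -/

/-- The height at `x` of the line through `p` and `q`. -/
noncomputable def lineHeight (p q : ℝ × ℝ) (x : ℝ) : ℝ := p.2 + (q.2 - p.2) / (q.1 - p.1) * (x - p.1)

theorem lineHeight_left (p q : ℝ × ℝ) : lineHeight p q p.1 = p.2 := by simp [lineHeight]

theorem lineHeight_right {p q : ℝ × ℝ} (h : p.1 ≠ q.1) : lineHeight p q q.1 = q.2 := by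
  have : q.1 - p.1 ≠ 0 := sub_ne_zero.2 h.symm
  rw [lineHeight, div_mul_cancel₀ _ this]
  ring

theorem mem_segment_iff_lineHeight {p q w : ℝ × ℝ} (h : p.1 ≠ q.1) :
    w ∈ segment ℝ p q ↔ w.1 ∈ Set.uIcc p.1 q.1 ∧ w.2 = lineHeight p q w.1 := by
  have h' : q.1 - p.1 ≠ 0 := sub_ne_zero.2 h.symm
  constructor
  · intro hw
    rw [segment_eq_image_lineMap] at hw
    obtain ⟨t, ht, rfl⟩ := hw
    refine ⟨(MonoPath.lineMap p q).fst_mem ht, ?_⟩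
    simp only [lineHeight, AffineMap.lineMap_apply, Prod.smul_fst, Prod.smul_snd, vsub_eq_sub, vadd_eq_add, smul_eq_mul,
      Prod.fst_add, Prod.snd_add, Prod.fst_sub, Prod.snd_sub]
    field_simp
    ring
  · rintro ⟨h1, h2⟩
    have hc := (MonoPath.lineMap p q).continuousOn_fst
    obtain ⟨t, ht, hw⟩ := hc.surjOn_uIcc zero_mem_Icc one_mem_Icc (by simpa using h1)
    rw [segment_eq_image_lineMap]
    refine ⟨t, ht, Prod.ext hw ?_⟩
    rw [h2, ← hw]
    simp only [lineHeight, AffineMap.lineMap_apply, Prod.smul_fst, Prod.smul_snd, vsub_eq_sub, vadd_eq_add, smul_eq_mul,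
      Prod.fst_add, Prod.snd_add, Prod.fst_sub, Prod.snd_sub]
    field_simp
    ring

theorem mem_segment_of_vertical {x y₁ y₂ y : ℝ} (h : y ∈ Set.uIcc y₁ y₂) :
    (x, y) ∈ segment ℝ (x, y₁) (x, y₂) := by
  rw [← segment_eq_uIcc] at h
  obtain ⟨s, t, hs, ht, hst, rfl⟩ := h
  exact ⟨s, t, hs, ht, hst, Prod.ext (by simp [← add_mul, hst]) rfl⟩

theorem mul_pos_of_notMem_uIcc {a b y : ℝ} (h : y ∉ Set.uIcc a b) : 0 < (a - y) * (b - y) := by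
  rw [Set.mem_uIcc, not_or, not_and_or, not_and_or, not_le, not_le, not_le, not_le] at h
  obtain ⟨h1 | h1, h2 | h2⟩ := h
  · exact mul_pos (by linarith) (by linarith)
  · linarith
  · linarith
  · exact mul_pos_of_neg_of_neg (by linarith) (by linarith)

/-- A continuous function without zeros and an affine function that have the same sign at the ends
of an interval: the affine function has no zero either. -/
theorem affine_ne_zero {D : ℝ → ℝ} {a b w α β : ℝ} (haw : a ≤ w) (hwb : w ≤ b)
    (hD : ContinuousOn D (Set.Icc a b)) (h0 : ∀ x ∈ Set.Icc a b, D x ≠ 0)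
    (ha : 0 < D a * (α + β * a)) (hb : 0 < D b * (α + β * b)) : α + β * w ≠ 0 := by
  have hab := haw.trans hwb
  -- A sign change of `D` would produce a zero of `D`. So the affine function has equal signs at `a`
  -- and `b`, and it lies between its end values.
  have hzero : ∀ {P : Prop}, (0 : ℝ) ∈ D '' Set.Icc a b → P := fun h =>
    (let ⟨x, hx, h'⟩ := h; h0 x hx h').elim
  rcases pos_and_pos_or_neg_and_neg_of_mul_pos ha with ⟨h1, h2⟩ | ⟨h1, h2⟩ <;>
    rcases pos_and_pos_or_neg_and_neg_of_mul_pos hb with ⟨h3, h4⟩ | ⟨h3, h4⟩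
  · rcases le_total 0 β with hβ | hβ
    · nlinarith [mul_le_mul_of_nonneg_left haw hβ]
    · nlinarith [mul_le_mul_of_nonpos_left hwb hβ]
  · exact hzero (intermediate_value_Icc' hab hD ⟨h3.le, h1.le⟩)
  · exact hzero (intermediate_value_Icc hab hD ⟨h1.le, h3.le⟩)
  · rcases le_total 0 β with hβ | hβ
    · nlinarith [mul_le_mul_of_nonneg_left hwb hβ]
    · nlinarith [mul_le_mul_of_nonpos_left haw hβ]

/-- The point `z` lies on no segment between a point of the path `f` from `p` to `q` and a point of
the straight path. -/
def Avoids (f : ℝ → ℝ × ℝ) (p q z : ℝ × ℝ) : Prop :=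
  ∀ t ∈ Set.Icc (0 : ℝ) 1, ∀ b ∈ segment ℝ p q, z ∉ segment ℝ (f t) b

theorem Avoids.swap {f : ℝ → ℝ × ℝ} {p q z : ℝ × ℝ} (h : Avoids f p q z) :
    Avoids (fun t => (f t).swap) p.swap q.swap z.swap := fun t ht b hb hz =>
  h t ht b.swap (by simpa using swap_mem_segment hb) (by simpa using swap_mem_segment hz)

namespace MonoPath

variable {f g : ℝ → ℝ × ℝ} {p q p' q' : ℝ × ℝ}

/-- `E` describes the path as a graph. The vertical segment from the path to the straight path at
abscissa `z.1` misses `z`, so `z` is above both or below both; the positive product records this. -/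
theorem exists_lineHeight (hf : MonoPath f p q) (h : p.1 ≠ q.1) :
    ∃ E : ℝ → ℝ, ContinuousOn E (Set.uIcc p.1 q.1) ∧ E p.1 = p.2 ∧ E q.1 = q.2 ∧
      (∀ x ∈ Set.uIcc p.1 q.1, ∃ t ∈ Set.Icc (0 : ℝ) 1, f t = (x, E x)) ∧
        ∀ z, Avoids f p q z → z.1 ∈ Set.uIcc p.1 q.1 →
          0 < (E z.1 - z.2) * (lineHeight p q z.1 - z.2) := by
  obtain ⟨E, hE, hEt⟩ := exists_graph hf.continuousOn_fst hf.continuousOn_snd (hf.injOn_fst h)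
  simp only [hf.source, hf.target] at hE hEt
  have hgraph : ∀ x ∈ Set.uIcc p.1 q.1, ∃ t ∈ Set.Icc (0 : ℝ) 1, f t = (x, E x) := by
    intro x hx
    rw [← hf.source, ← hf.target] at hx
    obtain ⟨t, ht, rfl⟩ := hf.continuousOn_fst.surjOn_uIcc zero_mem_Icc one_mem_Icc hx
    exact ⟨t, ht, Prod.ext rfl (hEt t ht).symm⟩
  refine ⟨E, hE, ?_, ?_, hgraph, fun z hz hz1 => mul_pos_of_notMem_uIcc fun hz2 => ?_⟩
  · simpa [hf.source] using hEt 0 zero_mem_Icc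
  · simpa [hf.target] using hEt 1 one_mem_Icc
  · obtain ⟨t, ht, hft⟩ := hgraph z.1 hz1
    refine hz t ht (z.1, lineHeight p q z.1) ((mem_segment_iff_lineHeight h).2 ⟨hz1, rfl⟩) ?_
    rw [hft]
    exact mem_segment_of_vertical hz2

/-- If the paths were disjoint, `E - F` would have no zero on the common interval of abscissae. At
both ends of it the difference of the lines has the sign of `E - F`, so `affine_ne_zero` contradicts
the common point `w` of the segments. -/
theorem exists_common_of_fst_ne (hf : MonoPath f p q) (hg : MonoPath g p' q') (h : p.1 ≠ q.1)
    (h' : p'.1 ≠ q'.1) (hp : Avoids g p' q' p) (hq : Avoids g p' q' q) (hp' : Avoids f p q p')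
    (hq' : Avoids f p q q') {w : ℝ × ℝ} (hw : w ∈ segment ℝ p q) (hw' : w ∈ segment ℝ p' q') :
    ∃ s ∈ Set.Icc (0 : ℝ) 1, ∃ t ∈ Set.Icc (0 : ℝ) 1, f s = g t := by
  by_contra hne
  obtain ⟨E, hE, hEp, hEq, hEf, hEz⟩ := hf.exists_lineHeight h
  obtain ⟨F, hF, hFp, hFq, hFg, hFz⟩ := hg.exists_lineHeight h'
  rw [mem_segment_iff_lineHeight h] at hw
  rw [mem_segment_iff_lineHeight h'] at hw'
  obtain ⟨hw1, hw2⟩ := hw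
  obtain ⟨hw1', hw2'⟩ := hw'
  have hD : ∀ x ∈ Set.uIcc p.1 q.1, x ∈ Set.uIcc p'.1 q'.1 → E x - F x ≠ 0 := by
    intro x hx hx' h0
    obtain ⟨s, hs, hfs⟩ := hEf x hx
    obtain ⟨t, ht, hgt⟩ := hFg x hx'
    exact hne ⟨s, hs, t, ht, by rw [hfs, hgt, sub_eq_zero.1 h0]⟩
  set α := p.2 - (q.2 - p.2) / (q.1 - p.1) * p.1
    - (p'.2 - (q'.2 - p'.2) / (q'.1 - p'.1) * p'.1) with hα
  set β := (q.2 - p.2) / (q.1 - p.1) - (q'.2 - p'.2) / (q'.1 - p'.1) with hβ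
  have hαβ : ∀ x, α + β * x = lineHeight p q x - lineHeight p' q' x := fun x => by
    rw [hα, hβ, lineHeight, lineHeight]; ring
  -- At the abscissa of an end-point of one path, this path and its line have equal height, and the
  -- end-point lies on the same side of the other path and of the other line.
  have hend : ∀ x ∈ Set.uIcc p.1 q.1, x ∈ Set.uIcc p'.1 q'.1 →
      (x = p.1 ∨ x = q.1 ∨ x = p'.1 ∨ x = q'.1) → 0 < (E x - F x) * (α + β * x) := by
    rintro x hx hx' (rfl | rfl | rfl | rfl) <;> rw [hαβ]
    · rw [hEp, lineHeight_left]
      have := hFz p hp hx'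
      nlinarith
    · rw [hEq, lineHeight_right h]
      have := hFz q hq hx'
      nlinarith
    · rw [hFp, lineHeight_left]
      exact hEz p' hp' hx
    · rw [hFq, lineHeight_right h']
      exact hEz q' hq' hx
  -- The common interval: its left end is the larger minimum, its right end the smaller maximum, so
  -- both are abscissae of end-points.
  have hI : ∀ x, min p.1 q.1 ⊔ min p'.1 q'.1 ≤ x → x ≤ max p.1 q.1 ⊓ max p'.1 q'.1 →
      x ∈ Set.uIcc p.1 q.1 ∧ x ∈ Set.uIcc p'.1 q'.1 := fun x h1 h2 =>
    ⟨⟨le_sup_left.trans h1, h2.trans inf_le_left⟩, le_sup_right.trans h1, h2.trans inf_le_right⟩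
  have hwa : min p.1 q.1 ⊔ min p'.1 q'.1 ≤ w.1 := sup_le hw1.1 hw1'.1
  have hwb : w.1 ≤ max p.1 q.1 ⊓ max p'.1 q'.1 := le_inf hw1.2 hw1'.2
  have hmin : ∀ x y : ℝ, min x y = x ∨ min x y = y := min_choice
  have hmax : ∀ x y : ℝ, max x y = x ∨ max x y = y := max_choice
  refine affine_ne_zero (D := fun x => E x - F x) (α := α) (β := β) hwa hwb ?_ ?_ ?_ ?_ ?_
  · exact (hE.mono fun x hx => (hI x hx.1 hx.2).1).sub (hF.mono fun x hx => (hI x hx.1 hx.2).2)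
  · exact fun x hx => hD x (hI x hx.1 hx.2).1 (hI x hx.1 hx.2).2
  · have := hI _ le_rfl (hwa.trans hwb)
    refine hend _ this.1 this.2 ?_
    rcases hmax (min p.1 q.1) (min p'.1 q'.1) with h | h <;> rw [h]
    · rcases hmin p.1 q.1 with h | h <;> simp [h]
    · rcases hmin p'.1 q'.1 with h | h <;> simp [h]
  · have := hI _ (hwa.trans hwb) le_rfl
    refine hend _ this.1 this.2 ?_
    rcases hmin (max p.1 q.1) (max p'.1 q'.1) with h | h <;> rw [h]
    · rcases hmax p.1 q.1 with h | h <;> simp [h]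
    · rcases hmax p'.1 q'.1 with h | h <;> simp [h]
  · rw [hαβ, ← hw2, ← hw2', sub_self]

/-- If the straight paths meet, then the monotone paths meet as well, provided that the end-points
of each path stay away from the region that the other path sweeps while it is straightened. -/
theorem exists_common (hf : MonoPath f p q) (hg : MonoPath g p' q') (h : p ≠ q) (h' : p' ≠ q')
    (hp : Avoids g p' q' p) (hq : Avoids g p' q' q) (hp' : Avoids f p q p')
    (hq' : Avoids f p q q') {w : ℝ × ℝ} (hw : w ∈ segment ℝ p q) (hw' : w ∈ segment ℝ p' q') :
    ∃ s ∈ Set.Icc (0 : ℝ) 1, ∃ t ∈ Set.Icc (0 : ℝ) 1, f s = g t := by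
  by_cases h1 : p.1 ≠ q.1 ∧ p'.1 ≠ q'.1
  · exact hf.exists_common_of_fst_ne hg h1.1 h1.2 hp hq hp' hq' hw hw'
  by_cases h2 : p.2 ≠ q.2 ∧ p'.2 ≠ q'.2
  · obtain ⟨s, hs, t, ht, hst⟩ := hf.swap.exists_common_of_fst_ne hg.swap h2.1 h2.2 hp.swap hq.swap
      hp'.swap hq'.swap (swap_mem_segment hw) (swap_mem_segment hw')
    exact ⟨s, hs, t, ht, Prod.swap_injective hst⟩
  -- What remains is one vertical and one horizontal segment, each covered by its path; both paths
  -- contain `w`.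
  have h3 : ¬ (p.1 = q.1 ∧ p.2 = q.2) := fun h4 => h (Prod.ext h4.1 h4.2)
  have h3' : ¬ (p'.1 = q'.1 ∧ p'.2 = q'.2) := fun h4 => h' (Prod.ext h4.1 h4.2)
  obtain ⟨s, hs, hfs⟩ := hf.exists_eq_of_mem_segment hw (by tauto)
  obtain ⟨t, ht, hgt⟩ := hg.exists_eq_of_mem_segment hw' (by tauto)
  exact ⟨s, hs, t, ht, hfs.trans hgt.symm⟩

/-- By monotonicity the path and the straight path both lie beyond the line of the side except at
`p`, and so does everything between them. -/
theorem eq_of_mem_region {Q : Square} (hf : MonoPath f p q) (h : Q.Outward p q) {t : ℝ}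
    (ht : t ∈ Set.Icc (0 : ℝ) 1) {b z : ℝ × ℝ} (hb : b ∈ segment ℝ p q)
    (hz : z ∈ segment ℝ (f t) b) (hzQ : z ∈ Q.region) : z = p := by
  rw [segment_eq_image_lineMap] at hb
  obtain ⟨θ, hθ, rfl⟩ := hb
  have hl := lineMap p q
  exact h.eq_of_mem_segment (hf.fst_mem ht) (hf.snd_mem ht) (hf.eq_source_of_fst ht)
    (hf.eq_source_of_snd ht) (hl.fst_mem hθ) (hl.snd_mem hθ) (hl.eq_source_of_fst hθ)
    (hl.eq_source_of_snd hθ) hz hzQ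

theorem outset_nonpos (hf : MonoPath f p q) {s : Side} (h : s.outset p q ≤ 0) {t : ℝ}
    (ht : t ∈ Set.Icc (0 : ℝ) 1) : s.outset p (f t) ≤ 0 := by
  have h1 := hf.fst_mem ht
  have h2 := hf.snd_mem ht
  cases s <;> simp only [Side.outset, sub_nonpos] at h ⊢
  · rw [Set.uIcc_of_ge h] at h2; exact h2.2
  · rw [Set.uIcc_of_le h] at h2; exact h2.1
  · rw [Set.uIcc_of_le h] at h1; exact h1.1
  · rw [Set.uIcc_of_ge h] at h1; exact h1.2

/-- A path that leaves a square at the mid-point of a segment of a side goes outward. -/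
theorem outset_pos {Q : Square} {n j : ℕ} (h1 : 1 ≤ j) (hn : j ≤ n) {s : Side}
    (hf : MonoPath f (Q.midpoint n j s) q)
    (hQ : ∀ t ∈ Set.Ioo (0 : ℝ) 1, f t ∉ Q.region) : 0 < s.outset (Q.midpoint n j s) q := by
  by_contra hneg
  -- Interior points of the path tend to the mid-point. Near it, points that do not lie outward
  -- belong to `Q`, which the path must avoid.
  have hc : Filter.Tendsto f (nhdsWithin 0 (Set.Ioo 0 1)) (nhds (Q.midpoint n j s)) := by
    have := hf.continuousOn 0 zero_mem_Icc
    rw [ContinuousWithinAt, hf.source] at this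
    exact this.mono_left (nhdsWithin_mono _ Set.Ioo_subset_Icc_self)
  have hne : (nhdsWithin (0 : ℝ) (Set.Ioo 0 1)).NeBot := by
    rw [← mem_closure_iff_nhdsWithin_neBot, closure_Ioo zero_ne_one]
    exact zero_mem_Icc
  obtain ⟨t, ht, ht'⟩ := ((hc.eventually (Q.eventually_mem_region h1 hn s)).and
    self_mem_nhdsWithin).exists
  exact hQ t ht' (ht (hf.outset_nonpos (not_lt.1 hneg) (Set.Ioo_subset_Icc_self ht')))

end MonoPath

end NodeTrix

/-! ### Straight drawings -/

namespace NodeTrix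

/-- Twice the signed area of a triangle. -/
def orient (a b c : ℝ × ℝ) : ℝ := (b.1 - a.1) * (c.2 - a.2) - (b.2 - a.2) * (c.1 - a.1)

/-- Each of the segments from `p` to `q` and from `p'` to `q'` has its ends on both sides of the
line through the other one. -/
def ProperCross (p q p' q' : ℝ × ℝ) : Prop :=
  orient p q p' * orient p q q' < 0 ∧ orient p' q' p * orient p' q' q < 0

/-- Cramer's rule gives the parameters of the intersection as quotients of orientations; opposite
signs make the denominators non-zero and put the quotients in `[0, 1]`. -/
theorem ProperCross.exists_mem {p q p' q' : ℝ × ℝ} (h : ProperCross p q p' q') :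
    ∃ w, w ∈ segment ℝ p q ∧ w ∈ segment ℝ p' q' := by
  have key : ∀ {a b : ℝ}, a * b < 0 → a - b ≠ 0 ∧ a / (a - b) ∈ Set.Icc (0 : ℝ) 1 := by
    intro a b hab
    rcases mul_neg_iff.1 hab with ⟨ha, hb⟩ | ⟨ha, hb⟩
    · have : 0 < a - b := by linarith
      exact ⟨this.ne', div_nonneg ha.le this.le, (div_le_one this).2 (by linarith)⟩
    · have : a - b < 0 := by linarith
      exact ⟨this.ne, div_nonneg_of_nonpos ha.le this.le, (div_le_one_of_neg this).2 (by linarith)⟩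
  obtain ⟨h1, h2⟩ := key h.1
  obtain ⟨h3, h4⟩ := key h.2
  have ht := div_mul_cancel₀ (orient p q p') h1
  have hs := div_mul_cancel₀ (orient p' q' p) h3
  set t := orient p q p' / (orient p q p' - orient p q q')
  set s := orient p' q' p / (orient p' q' p - orient p' q' q)
  refine ⟨AffineMap.lineMap p q s, ?_, ?_⟩
  · rw [segment_eq_image_lineMap]; exact ⟨s, h4, rfl⟩
  · rw [segment_eq_image_lineMap]
    refine ⟨t, h2, Prod.ext ?_ ?_⟩ <;> apply mul_right_cancel₀ h3 <;>
      simp only [orient] at hs ht ⊢ <;>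
      simp only [AffineMap.lineMap_apply, Prod.smul_fst, Prod.smul_snd, vsub_eq_sub, vadd_eq_add,
        smul_eq_mul, Prod.fst_add, Prod.snd_add, Prod.fst_sub, Prod.snd_sub]
    · linear_combination -(q'.1 - p'.1) * ht - (q.1 - p.1) * hs
    · linear_combination -(q'.2 - p'.2) * ht - (q.2 - p.2) * hs

theorem exists_lineMap_of_orient {p q z : ℝ × ℝ} (hpq : p ≠ q) (h : orient p q z = 0) :
    ∃ α : ℝ, z = AffineMap.lineMap p q α := by
  have hx : ∀ α : ℝ, (AffineMap.lineMap p q α : ℝ × ℝ)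
      = (p.1 + α * (q.1 - p.1), p.2 + α * (q.2 - p.2)) := fun α => by
    ext <;> simp [AffineMap.lineMap_apply, add_comm]
  rw [orient] at h
  by_cases h1 : q.1 - p.1 = 0
  · have h2 : q.2 - p.2 ≠ 0 := fun h2 => hpq (Prod.ext (by linarith) (by linarith))
    refine ⟨(z.2 - p.2) / (q.2 - p.2), ?_⟩
    rw [hx]
    refine Prod.ext ?_ ?_
    · have : (q.2 - p.2) * (z.1 - p.1) = 0 := by rw [h1] at h; linarith
      have := (mul_eq_zero.1 this).resolve_left h2
      simp only [h1]; linarith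
    · simp only [div_mul_cancel₀ _ h2]; ring
  · refine ⟨(z.1 - p.1) / (q.1 - p.1), ?_⟩
    rw [hx]
    refine Prod.ext ?_ ?_
    · simp only [div_mul_cancel₀ _ h1]; ring
    · simp only
      field_simp
      linarith

theorem lineMap_mem_segment_lineMap (p q : ℝ × ℝ) {α β θ : ℝ} (h : θ ∈ Set.uIcc α β) :
    AffineMap.lineMap p q θ ∈
      segment ℝ (AffineMap.lineMap p q α : ℝ × ℝ) (AffineMap.lineMap p q β) := by
  rw [← segment_eq_uIcc] at h
  rw [← image_segment]
  exact ⟨θ, h, rfl⟩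

section EndPoints

variable {p q p' q' : ℝ × ℝ} (hpq : p ≠ q) (hp' : p' ∈ segment ℝ p q → p' = p)
  (hq' : q' ∈ segment ℝ p q → q' = q) (hp : p ∈ segment ℝ p' q' → p = p')
  (hq : q ∈ segment ℝ p' q' → q = q')
include hpq hp' hq' hp hq

/-- On the line through `p` and `q`, with these points at `0` and `1`, the other ends sit at `α` and
`β`. A common interior point forces one end of each overlapping pair into the other segment, where
only corresponding ends may coincide; this leaves `α = 0` and `β = 1`. -/
theorem eq_and_eq_of_collinear (h1 : orient p q p' = 0) (h2 : orient p q q' = 0) {s t : ℝ}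
    (hs : s ∈ Set.Ioo (0 : ℝ) 1) (ht : t ∈ Set.Ioo (0 : ℝ) 1)
    (hst : (AffineMap.lineMap p q s : ℝ × ℝ) = AffineMap.lineMap p' q' t) : p = p' ∧ q = q' := by
  have hinj : Function.Injective (AffineMap.lineMap p q : ℝ → ℝ × ℝ) :=
    AffineMap.lineMap_injective ℝ hpq
  obtain ⟨α, rfl⟩ := exists_lineMap_of_orient hpq h1
  obtain ⟨β, rfl⟩ := exists_lineMap_of_orient hpq h2
  obtain ⟨hs0, hs1⟩ := hs
  obtain ⟨ht0, ht1⟩ := ht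
  have hmem : ∀ {θ : ℝ}, 0 ≤ θ → θ ≤ 1 → (AffineMap.lineMap p q θ : ℝ × ℝ) ∈ segment ℝ p q := by
    intro θ h0 h1
    rw [segment_eq_image_lineMap]
    exact ⟨θ, ⟨h0, h1⟩, rfl⟩
  have h0 : p = AffineMap.lineMap p q (0 : ℝ) := by simp
  have h1' : q = AffineMap.lineMap p q (1 : ℝ) := by simp
  have hs' : s = (1 - t) * α + t * β := by
    apply hinj
    rw [hst]
    ext <;> simp [AffineMap.lineMap_apply] <;> ring
  have ha : α ∈ Set.Icc (0 : ℝ) 1 → α = 0 := fun h => hinj ((hp' (hmem h.1 h.2)).trans h0)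
  have hb : β ∈ Set.Icc (0 : ℝ) 1 → β = 1 := fun h => hinj ((hq' (hmem h.1 h.2)).trans h1')
  have ha' : (0 : ℝ) ∈ Set.uIcc α β → α = 0 := fun h => by
    have := lineMap_mem_segment_lineMap p q h
    rw [← h0] at this
    exact hinj ((hp this).symm.trans h0)
  have hb' : (1 : ℝ) ∈ Set.uIcc α β → β = 1 := fun h => by
    have := lineMap_mem_segment_lineMap p q h
    rw [← h1'] at this
    exact hinj ((hq this).symm.trans h1')
  have hα : α = 0 := by
    rcases lt_or_ge α 0 with h | h
    · exact ha' (Set.mem_uIcc_of_le h.le (by by_contra hn; nlinarith))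
    · rcases le_or_gt α 1 with h' | h'
      · exact ha ⟨h, h'⟩
      · have hβ : β < 1 := by by_contra hn; nlinarith
        exact absurd (hb' (Set.mem_uIcc_of_ge hβ.le h'.le)) hβ.ne
  subst hα
  have hβ : β = 1 := by
    have h : 0 ≤ β := by by_contra hn; nlinarith
    rcases le_or_gt β 1 with h' | h'
    · exact hb ⟨h, h'⟩
    · exact hb' (Set.mem_uIcc_of_le zero_le_one h'.le)
  subst hβ
  exact ⟨h0, h1'⟩

/-- Segments that do not cross properly, and none of which contains an end-point of the other one
except a common one, have at most an end-point in common. -/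
theorem common_end_of_not_properCross (hpq' : p' ≠ q') (h : ¬ ProperCross p q p' q')
    (hne : ¬ (p = p' ∧ q = q')) {w : ℝ × ℝ} (hw : w ∈ segment ℝ p q)
    (hw' : w ∈ segment ℝ p' q') : (w = p ∧ w = p') ∨ (w = q ∧ w = q') := by
  have hmem := hw
  have hmem' := hw'
  rw [segment_eq_image_lineMap] at hw hw'
  obtain ⟨s, ⟨hs0, hs1⟩, rfl⟩ := hw
  obtain ⟨t, ⟨ht0, ht1⟩, hst⟩ := hw'
  rcases hs0.eq_or_lt with rfl | hs0
  · simp only [AffineMap.lineMap_apply_zero] at hmem' ⊢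
    exact .inl ⟨trivial, hp hmem'⟩
  rcases hs1.eq_or_lt with rfl | hs1
  · simp only [AffineMap.lineMap_apply_one] at hmem' ⊢
    exact .inr ⟨trivial, hq hmem'⟩
  rw [← hst] at hmem ⊢
  rcases ht0.eq_or_lt with rfl | ht0
  · simp only [AffineMap.lineMap_apply_zero] at hmem ⊢
    exact .inl ⟨hp' hmem, trivial⟩
  rcases ht1.eq_or_lt with rfl | ht1
  · simp only [AffineMap.lineMap_apply_one] at hmem ⊢
    exact .inr ⟨hq' hmem, trivial⟩
  exfalso
  have h1 := congrArg Prod.fst hst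
  have h2 := congrArg Prod.snd hst
  simp only [AffineMap.lineMap_apply, Prod.smul_fst, Prod.smul_snd, vsub_eq_sub, vadd_eq_add,
    smul_eq_mul, Prod.fst_add, Prod.snd_add, Prod.fst_sub, Prod.snd_sub] at h1 h2
  -- `orient p q` is affine and vanishes at the common point, so its values at `p'` and `q'` have
  -- opposite signs or both vanish.
  have h3 : (1 - t) * orient p q p' + t * orient p q q' = 0 := by
    simp only [orient]
    linear_combination (q.1 - p.1) * h2 - (q.2 - p.2) * h1
  have h4 : (1 - s) * orient p' q' p + s * orient p' q' q = 0 := by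
    simp only [orient]
    linear_combination -(q'.1 - p'.1) * h2 + (q'.2 - p'.2) * h1
  have key : ∀ {a b r : ℝ}, 0 < r → r < 1 → (1 - r) * a + r * b = 0 → a * b < 0 ∨ a = 0 ∧ b = 0 := by
    intro a b r hr0 hr1 hr
    rcases lt_trichotomy a 0 with ha | rfl | ha
    · exact .inl (mul_neg_of_neg_of_pos ha (by by_contra hn; nlinarith))
    · exact .inr ⟨rfl, by nlinarith⟩
    · exact .inl (mul_neg_of_pos_of_neg ha (by by_contra hn; nlinarith))
  rcases key ht0 ht1 h3 with h5 | ⟨h5, h6⟩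
  · rcases key hs0 hs1 h4 with h7 | ⟨h7, h8⟩
    · exact h ⟨h5, h7⟩
    · obtain ⟨h9, h10⟩ := eq_and_eq_of_collinear hpq' hp hq hp' hq' h7 h8 ⟨ht0, ht1⟩ ⟨hs0, hs1⟩ hst
      exact hne ⟨h9.symm, h10.symm⟩
  · exact hne (eq_and_eq_of_collinear hpq hp' hq' hp hq h5 h6 ⟨hs0, hs1⟩ ⟨ht0, ht1⟩ hst.symm)

end EndPoints

namespace Instance

variable (I : Instance)

/-- The incidence point at `u` of the edge `s(u, v)`. -/
noncomputable def point (u v : Fin I.n) : ℝ × ℝ :=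
  I.G.incidencePoint I.order I.side I.square u v

/-- The straight drawing of the instance is a monotone locally planar representation. -/
structure Straight : Prop where
  apart : ∀ u v, I.G.cluster u ≠ I.G.cluster v →
    (I.square (I.G.cluster u)).Apart (I.square (I.G.cluster v))
  pipe : ∀ u v, I.G.Inter u v → ∀ w, I.G.cluster w ≠ I.G.cluster u →
    I.G.cluster w ≠ I.G.cluster v → ¬ (I.square (I.G.cluster w)).MeetsPipe
      (I.square (I.G.cluster u)) (I.square (I.G.cluster v))
  outward : ∀ u v, I.G.Inter u v → 0 < (I.side u v).outset (I.point u v) (I.point v u)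
  not_cross : ∀ u v u' v', I.G.Inter u v → I.G.Inter u' v' → I.G.cluster u = I.G.cluster u' →
    ¬ ProperCross (I.point u v) (I.point v u) (I.point u' v') (I.point v' u')

/-! ### An instance is positive if and only if its straight drawing works. -/

variable {I}

theorem inter_symm {u v : Fin I.n} (h : I.G.Inter u v) : I.G.Inter v u := ⟨h.1.symm, h.2.symm⟩

theorem point_mem_region (u v : Fin I.n) : I.point u v ∈ (I.square (I.G.cluster u)).region :=
  Square.midpoint_mem_region _ (I.pos_pos u) (I.pos_le u) _

theorem point_injective {u v u' v' : Fin I.n} (hc : I.G.cluster u = I.G.cluster u')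
    (h : I.point u v = I.point u' v') : u = u' := by
  simp only [point, ClusteredGraph.incidencePoint, ← hc] at h
  refine (I.order.bijOn (I.G.cluster u)).injOn rfl hc.symm ?_
  exact Square.midpoint_injective _ (I.pos_pos u) (I.pos_le u) _ (I.pos_pos u')
    (hc ▸ I.pos_le u') h

/-- Clusters are non-empty, so conditions quantified over vertices reach every square. -/
theorem Straight.disjoint (h : I.Straight) {c d : Fin I.k} (hcd : c ≠ d) :
    Disjoint (I.square c).region (I.square d).region := by
  obtain ⟨u, rfl⟩ := I.G.cluster_surjective c
  obtain ⟨v, rfl⟩ := I.G.cluster_surjective d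
  exact (disjoint_region_iff _ _).2 (h.apart u v hcd)

theorem Straight.disjoint_pipe (h : I.Straight) {u v : Fin I.n} (huv : I.G.Inter u v)
    {c : Fin I.k} (hu : c ≠ I.G.cluster u) (hv : c ≠ I.G.cluster v) :
    Disjoint (NodeTrix.pipe (I.square (I.G.cluster u)) (I.square (I.G.cluster v)))
      (I.square c).region := by
  obtain ⟨w, rfl⟩ := I.G.cluster_surjective c
  exact (disjoint_pipe_iff _ _ _).2 (h.pipe u v huv w hu hv)

theorem left_mem_pipe {Q R : Square} {z : ℝ × ℝ} (h : z ∈ Q.region) : z ∈ NodeTrix.pipe Q R :=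
  subset_convexHull ℝ _ (.inl h)

theorem right_mem_pipe {Q R : Square} {z : ℝ × ℝ} (h : z ∈ R.region) : z ∈ NodeTrix.pipe Q R :=
  subset_convexHull ℝ _ (.inr h)

theorem segment_subset_pipe (u v : Fin I.n) : segment ℝ (I.point u v) (I.point v u) ⊆
    NodeTrix.pipe (I.square (I.G.cluster u)) (I.square (I.G.cluster v)) :=
  (convex_convexHull ℝ _).segment_subset (left_mem_pipe (point_mem_region u v))
    (right_mem_pipe (point_mem_region v u))

/-- The swept region of an inter-cluster edge contains no point of a square besides the ends. -/
theorem avoids_of_mem_region {f : ℝ → ℝ × ℝ} {u v : Fin I.n} {c : Fin I.k}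
    (hf : MonoPath f (I.point u v) (I.point v u))
    (hfp : ∀ t ∈ Set.Icc (0 : ℝ) 1,
      f t ∈ NodeTrix.pipe (I.square (I.G.cluster u)) (I.square (I.G.cluster v)))
    (hu : 0 < (I.side u v).outset (I.point u v) (I.point v u))
    (hv : 0 < (I.side v u).outset (I.point v u) (I.point u v))
    (hpipe : c ≠ I.G.cluster u → c ≠ I.G.cluster v →
      Disjoint (NodeTrix.pipe (I.square (I.G.cluster u)) (I.square (I.G.cluster v)))
        (I.square c).region) {z : ℝ × ℝ} (hz : z ∈ (I.square c).region)
    (hzu : c = I.G.cluster u → z ≠ I.point u v) (hzv : c = I.G.cluster v → z ≠ I.point v u) :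
    Avoids f (I.point u v) (I.point v u) z := by
  intro t ht b hb hzb
  by_cases hcu : c = I.G.cluster u
  · subst hcu
    exact hzu rfl (hf.eq_of_mem_region (Square.outward_midpoint _ _ hu) ht hb hzb hz)
  by_cases hcv : c = I.G.cluster v
  · subst hcv
    refine hzv rfl (hf.reverse.eq_of_mem_region (Square.outward_midpoint _ _ hv) (t := 1 - t)
      ⟨by linarith [ht.2], by linarith [ht.1]⟩ (by rwa [segment_symm]) ?_ hz)
    rwa [sub_sub_cancel]
  · exact Set.disjoint_left.1 (hpipe hcu hcv) ((convex_convexHull ℝ _).segment_subset (hfp t ht)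
      (segment_subset_pipe u v hb) hzb) hz

theorem Straight.eq_of_mem_region (h : I.Straight) {u v : Fin I.n} (huv : I.G.Inter u v)
    {c : Fin I.k} {z : ℝ × ℝ} (hz : z ∈ segment ℝ (I.point u v) (I.point v u))
    (hzc : z ∈ (I.square c).region) :
    (c = I.G.cluster u ∧ z = I.point u v) ∨ (c = I.G.cluster v ∧ z = I.point v u) := by
  by_contra hn
  simp only [not_or, not_and] at hn
  -- The straight path sweeps only itself: the segment from its point at parameter `0` to the far
  -- end is the whole edge.
  refine avoids_of_mem_region (MonoPath.lineMap _ _) (fun t ht => segment_subset_pipe u v ?_)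
    (h.outward u v huv) (h.outward v u (inter_symm huv)) (fun hu hv => h.disjoint_pipe huv hu hv)
    hzc hn.1 hn.2 0 zero_mem_Icc _ (right_mem_segment ℝ _ _) (by simpa using hz)
  rw [segment_eq_image_lineMap]
  exact ⟨t, ht, rfl⟩

theorem point_ne_point {u v : Fin I.n} {x y : Fin I.n}
    (h : Disjoint (I.square (I.G.cluster u)).region (I.square (I.G.cluster v)).region) :
    I.point u x ≠ I.point v y := fun he =>
  Set.disjoint_left.1 h (point_mem_region u x) (he ▸ point_mem_region v y)

theorem isArc_segment {p q : ℝ × ℝ} (h : p ≠ q) : IsArc (segment ℝ p q) p q :=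
  ⟨AffineMap.lineMap p q, AffineMap.lineMap_continuous.continuousOn,
    (AffineMap.lineMap_injective ℝ h).injOn, by simp, by simp,
    (segment_eq_image_lineMap ℝ p q).symm⟩

theorem isXYMonotone_segment (p q : ℝ × ℝ) : IsXYMonotone (segment ℝ p q) := by
  by_cases h : p.1 = q.1 ∨ p.2 = q.2
  · exact .inl ⟨p, q, h, rfl⟩
  · rw [not_or] at h
    refine .inr ?_
    rw [segment_eq_image_lineMap]
    have hl := MonoPath.lineMap p q
    constructor
    · rintro _ ⟨s, hs, rfl⟩ _ ⟨t, ht, rfl⟩ hst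
      rw [hl.injOn_fst h.1 hs ht hst]
    · rintro _ ⟨s, hs, rfl⟩ _ ⟨t, ht, rfl⟩ hst
      rw [hl.injOn_snd h.2 hs ht hst]

/-- The straight drawing. -/
noncomputable def drawing (I : Instance) : Sym2 (Fin I.n) → Set (ℝ × ℝ) :=
  Sym2.lift ⟨fun u v => segment ℝ (I.point u v) (I.point v u), fun _ _ => segment_symm ℝ _ _⟩

/-- Incidence points lie on squares and a segment meets squares only at its own ends, so touching is
possible only at corresponding ends, and `common_end_of_not_properCross` applies. -/
theorem Straight.isYes (h : I.Straight) : I.IsYes := by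
  let Γ : Representation I.G :=
    { order := I.order
      side := I.side
      square := I.square
      disjoint := fun _ _ => h.disjoint
      drawing := I.drawing
      isArc := fun u v huv => isArc_segment (point_ne_point (h.disjoint huv.2)) }
  refine ⟨Γ, ⟨fun u v _ => isXYMonotone_segment _ _, rfl,
    fun u v huv c hu hv => h.disjoint_pipe huv hu hv, fun u v _ => segment_subset_pipe u v⟩,
    ⟨?_, ?_⟩, rfl, fun _ _ _ => rfl⟩
  · rintro u v u' v' huv huv' hne hc ⟨w, ⟨hw, hw'⟩, hend⟩
    change ¬ ((w = I.point u v ∨ w = I.point v u) ∧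
      (w = I.point u' v' ∨ w = I.point v' u')) at hend
    have key : (w = I.point u v ∧ w = I.point u' v') ∨ (w = I.point v u ∧ w = I.point v' u') := by
      refine common_end_of_not_properCross (point_ne_point (h.disjoint huv.2)) ?_ ?_ ?_ ?_
        (point_ne_point (h.disjoint huv'.2)) (h.not_cross u v u' v' huv huv' hc) ?_ hw hw'
      · intro hm
        rcases h.eq_of_mem_region huv hm (point_mem_region u' v') with ⟨_, h'⟩ | ⟨h', _⟩
        · exact h'
        · exact (huv.2 (hc.trans h')).elim
      · intro hm
        rcases h.eq_of_mem_region huv hm (point_mem_region v' u') with ⟨h', _⟩ | ⟨_, h'⟩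
        · exact (huv'.2 (hc.symm.trans h'.symm)).elim
        · exact h'
      · intro hm
        rcases h.eq_of_mem_region huv' hm (point_mem_region u v) with ⟨_, h'⟩ | ⟨h', _⟩
        · exact h'
        · exact (huv'.2 (hc.symm.trans h')).elim
      · intro hm
        rcases h.eq_of_mem_region huv' hm (point_mem_region v u) with ⟨h', _⟩ | ⟨_, h'⟩
        · exact (huv.2 (hc.trans h'.symm)).elim
        · exact h'
      -- Incidence points determine their cluster and vertex, so two edges with the same pair of
      -- points would be equal.
      · rintro ⟨h1, h2⟩
        have hu := point_injective hc h1
        have hcv : I.G.cluster v = I.G.cluster v' := by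
          by_contra hcv
          exact point_ne_point (h.disjoint hcv) h2
        rw [hu, point_injective hcv h2] at hne
        exact hne rfl
    rcases key with ⟨h1, h2⟩ | ⟨h1, h2⟩
    · exact hend ⟨.inl h1, .inl h2⟩
    · exact hend ⟨.inr h1, .inr h2⟩
  · rintro u v huv c z ⟨hz, hzc⟩
    exact (h.eq_of_mem_region huv hz hzc).imp And.right And.right

theorem IsYes.straight (h : I.IsYes) : I.Straight := by
  obtain ⟨Γ, hM, hL, ho, hs⟩ := h
  have hpt : ∀ u v, I.G.Inter u v → Γ.point u v = I.point u v := fun u v huv => by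
    simp only [Representation.point, point, ClusteredGraph.incidencePoint, hM.square_eq, ho,
      hs u v huv]
  have hdisj : ∀ {c d : Fin I.k}, c ≠ d → Disjoint (I.square c).region (I.square d).region :=
    fun {c d} hcd => hM.square_eq ▸ Γ.disjoint c d hcd
  have hpipe : ∀ {u v : Fin I.n}, I.G.Inter u v → ∀ {c : Fin I.k}, c ≠ I.G.cluster u →
      c ≠ I.G.cluster v →
      Disjoint (NodeTrix.pipe (I.square (I.G.cluster u)) (I.square (I.G.cluster v)))
        (I.square c).region := fun {u v} huv {c} hu hv => by
    have := hM.pipe_disjoint u v huv c hu hv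
    rwa [hM.square_eq] at this
  have hpath : ∀ {u v : Fin I.n}, I.G.Inter u v → ∃ f, MonoPath f (I.point u v) (I.point v u) ∧
      f '' Set.Icc 0 1 = Γ.drawing s(u, v) := fun {u v} huv => by
    have := Γ.isArc u v huv
    change IsArc _ (Γ.point u v) (Γ.point v u) at this
    rw [hpt u v huv, hpt v u (inter_symm huv)] at this
    exact this.exists_monoPath (hM.monotone u v huv)
  have hout : ∀ u v, I.G.Inter u v → 0 < (I.side u v).outset (I.point u v) (I.point v u) := by
    intro u v huv
    obtain ⟨f, hf, hfd⟩ := hpath huv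
    refine hf.outset_pos (I.pos_pos u) (I.pos_le u) fun t ht htQ => ?_
    have ht' := Set.Ioo_subset_Icc_self ht
    have hinj := hf.injOn (point_ne_point (hdisj huv.2))
    have hav := hL.avoids_matrices u v huv (I.G.cluster u) (f t)
      ⟨hfd ▸ ⟨t, ht', rfl⟩, by rw [hM.square_eq]; exact htQ⟩
    rw [hpt u v huv, hpt v u (inter_symm huv)] at hav
    rcases hav with h | h
    · exact ht.1.ne' (hinj ht' zero_mem_Icc (h.trans hf.source.symm))
    · exact ht.2.ne (hinj ht' one_mem_Icc (h.trans hf.target.symm))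
  -- No incidence point is swept over while an arc is straightened, apart from the ends of the arc.
  have hav : ∀ {u v : Fin I.n} (_ : I.G.Inter u v) {f : ℝ → ℝ × ℝ},
      MonoPath f (I.point u v) (I.point v u) → f '' Set.Icc 0 1 = Γ.drawing s(u, v) →
      ∀ {x y : Fin I.n}, I.point x y ≠ I.point u v → I.point x y ≠ I.point v u →
        Avoids f (I.point u v) (I.point v u) (I.point x y) := by
    intro u v huv f hf hfd x y h1 h2
    refine avoids_of_mem_region hf (fun t ht => ?_) (hout u v huv) (hout v u (inter_symm huv))
      (hpipe huv) (point_mem_region x y) (fun _ => h1) fun _ => h2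
    have := hM.subset_pipe u v huv (hfd ▸ ⟨t, ht, rfl⟩ : f t ∈ _)
    rwa [hM.square_eq] at this
  refine ⟨fun u v huv => (disjoint_region_iff _ _).1 (hdisj huv),
    fun u v huv w hu hv => (disjoint_pipe_iff _ _ _).1 (hpipe huv hu hv), hout, ?_⟩
  intro u v u' v' huv huv' hc hcross
  -- A common end-point makes an orientation vanish, so a proper crossing involves two different
  -- edges without common end-points.
  have hne1 : I.point u v ≠ I.point u' v' := fun h => by
    have := hcross.1; rw [← h] at this; simp [orient] at this
  have hne2 : I.point v u ≠ I.point u' v' := fun h => by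
    have := hcross.1; rw [← h] at this; simp [orient, mul_comm] at this
  have hne3 : I.point u v ≠ I.point v' u' := fun h => by
    have := hcross.1; rw [← h] at this; simp [orient] at this
  have hne4 : I.point v u ≠ I.point v' u' := fun h => by
    have := hcross.1; rw [← h] at this; simp [orient, mul_comm] at this
  have hedge : s(u, v) ≠ s(u', v') := fun h => by
    rcases Sym2.eq_iff.1 h with ⟨rfl, rfl⟩ | ⟨rfl, rfl⟩
    · exact hne1 rfl
    · exact hne2 rfl
  obtain ⟨w, hw, hw'⟩ := hcross.exists_mem
  obtain ⟨f, hf, hfd⟩ := hpath huv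
  obtain ⟨g, hg, hgd⟩ := hpath huv'
  obtain ⟨s, hs, t, ht, hst⟩ := hf.exists_common hg (point_ne_point (hdisj huv.2))
    (point_ne_point (hdisj huv'.2)) (hav huv' hg hgd hne1 hne3) (hav huv' hg hgd hne2 hne4)
    (hav huv hf hfd hne1.symm hne2.symm) (hav huv hf hfd hne3.symm hne4.symm) hw hw'
  refine hL.not_cross u v u' v' huv huv' hedge hc
    ⟨f s, ⟨hfd ▸ ⟨s, hs, rfl⟩, hgd ▸ ⟨t, ht, hst.symm⟩⟩, ?_⟩
  rw [hpt u v huv, hpt v u (inter_symm huv), hpt u' v' huv', hpt v' u' (inter_symm huv')]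
  rintro ⟨h1 | h1, h2 | h2⟩
  · exact hne1 (h1.symm.trans h2)
  · exact hne3 (h1.symm.trans h2)
  · exact hne2 (h1.symm.trans h2)
  · exact hne4 (h1.symm.trans h2)

theorem isYes_iff_straight : I.IsYes ↔ I.Straight := ⟨IsYes.straight, Straight.isYes⟩

end Instance

end NodeTrix

/-! ### The decision procedure -/

namespace NodeTrix

/-- The incidence point at `u` of the edge `s(u, v)`, when the cluster of `u` has `m` vertices. -/
noncomputable def Instance.pointOfSize (I : Instance) (m : ℕ) (u v : Fin I.n) : ℝ × ℝ :=
  (I.square (I.G.cluster u)).midpoint m (I.order.pos u) (I.side u v)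

/-- A point both of whose coordinates are given by expressions. -/
def DefPoint (Γ : Ctx) (p : ∀ I, Γ.carrier I → ℝ × ℝ) : Prop :=
  DefReal Γ (fun I γ => (p I γ).1) ∧ DefReal Γ (fun I γ => (p I γ).2)

section Definability

variable {Γ : Ctx}

/-- The position of `w` stands in for the size of the cluster; doubling numerator and denominator
removes the `1 / 2` from the ratio. -/
theorem DefPoint.pointOfSize {u v w : ∀ I, Γ.carrier I → Fin I.n} (hu : IsVar Γ u)
    (hv : IsVar Γ v) (hw : IsVar Γ w) :
    DefPoint Γ (fun I γ => I.pointOfSize (I.order.pos (w I γ)) (u I γ) (v I γ)) := by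
  have hθ : DefReal Γ (fun I γ =>
      ((I.order.pos (u I γ) : ℝ) - 1 / 2) / (I.order.pos (w I γ) : ℝ)) :=
    (DefReal.div_int (((DefInt.const 2).mul (.pos hu)).sub (.const 1))
      ((DefInt.const 2).mul (.pos hw)) fun I γ => by
        have := I.pos_pos (w I γ)
        positivity).congr fun I γ => by
          have : (I.order.pos (w I γ) : ℝ) ≠ 0 := by exact_mod_cast (I.pos_pos (w I γ)).ne'
          push_cast
          field_simp
  have hx := DefReal.square_x hu
  have hy := DefReal.square_y hu
  have hl := DefReal.square_len hu
  constructor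
  · refine DefReal.side hu hv (g := fun s I γ => ((I.square (I.G.cluster (u I γ))).midpoint
      (I.order.pos (w I γ)) (I.order.pos (u I γ)) s).1) fun s => ?_
    cases s
    exacts [hx.add (hl.mul hθ), hx.add (hl.mul hθ), hx, hx.add hl]
  · refine DefReal.side hu hv (g := fun s I γ => ((I.square (I.G.cluster (u I γ))).midpoint
      (I.order.pos (w I γ)) (I.order.pos (u I γ)) s).2) fun s => ?_
    cases s
    exacts [hy.add hl, hy, (hy.add hl).sub (hl.mul hθ), (hy.add hl).sub (hl.mul hθ)]

/-- Incidence points may be used in formulas. -/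
theorem DefProp.point {u v : ∀ I, Γ.carrier I → Fin I.n} (hu : IsVar Γ u)
    {P : ∀ I, Γ.carrier I → ℝ × ℝ → Prop} (hP : DefProp Γ.ext (fun I γ =>
      P I γ.1 (I.pointOfSize (I.order.pos γ.2) (u I γ.1) (v I γ.1)))) :
    DefProp Γ (fun I γ => P I γ (I.point (u I γ) (v I γ))) :=
  DefProp.size hu (P := fun I γ m => P I γ (I.pointOfSize m (u I γ) (v I γ))) hP

theorem DefReal.orient {p q z : ∀ I, Γ.carrier I → ℝ × ℝ} (hp : DefPoint Γ p)
    (hq : DefPoint Γ q) (hz : DefPoint Γ z) :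
    DefReal Γ (fun I γ => orient (p I γ) (q I γ) (z I γ)) :=
  ((hq.1.sub hp.1).mul (hz.2.sub hp.2)).sub ((hq.2.sub hp.2).mul (hz.1.sub hp.1))

theorem DefReal.zero : DefReal Γ (fun _ _ => 0) :=
  (DefReal.const_int 0).congr fun _ _ => Int.cast_zero

theorem DefProp.properCross {p q p' q' : ∀ I, Γ.carrier I → ℝ × ℝ} (hp : DefPoint Γ p)
    (hq : DefPoint Γ q) (hp' : DefPoint Γ p') (hq' : DefPoint Γ q') :
    DefProp Γ (fun I γ => ProperCross (p I γ) (q I γ) (p' I γ) (q' I γ)) :=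
  (DefProp.lt ((DefReal.orient hp hq hp').mul (.orient hp hq hq')) .zero).and
    (DefProp.lt ((DefReal.orient hp' hq' hp).mul (.orient hp' hq' hq)) .zero)

section Vertices

variable {u v w : ∀ I, Γ.carrier I → Fin I.n} (hu : IsVar Γ u) (hv : IsVar Γ v)
include hu hv

theorem DefProp.outward : DefProp Γ (fun I γ => 0 < (I.side (u I γ) (v I γ)).outset
    (I.point (u I γ) (v I γ)) (I.point (v I γ) (u I γ))) := by
  refine DefProp.point hu (P := fun I γ p => 0 < (I.side (u I γ) (v I γ)).outset p
    (I.point (v I γ) (u I γ))) ?_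
  refine DefProp.point (Γ := Γ.ext) hv.weaken (P := fun I γ q =>
    0 < (I.side (u I γ.1) (v I γ.1)).outset
      (I.pointOfSize (I.order.pos γ.2) (u I γ.1) (v I γ.1)) q) ?_
  have hp := DefPoint.pointOfSize hu.weaken.weaken hv.weaken.weaken (IsVar.last (Γ := Γ)).weaken
  have hq := DefPoint.pointOfSize hv.weaken.weaken hu.weaken.weaken (IsVar.last (Γ := Γ.ext))
  refine DefProp.lt .zero (DefReal.side hu.weaken.weaken hv.weaken.weaken (g := fun s I γ =>
    s.outset (I.pointOfSize (I.order.pos γ.1.2) (u I γ.1.1) (v I γ.1.1))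
      (I.pointOfSize (I.order.pos γ.2) (v I γ.1.1) (u I γ.1.1))) fun s => ?_)
  cases s
  exacts [hq.2.sub hp.2, hp.2.sub hq.2, hp.1.sub hq.1, hq.1.sub hp.1]

/-- Each of the four incidence points takes one auxiliary variable, a last vertex of its cluster,
which supplies the cluster size. -/
theorem DefProp.properCross_point {u' v' : ∀ I, Γ.carrier I → Fin I.n} (hu' : IsVar Γ u')
    (hv' : IsVar Γ v') : DefProp Γ (fun I γ => ProperCross (I.point (u I γ) (v I γ))
      (I.point (v I γ) (u I γ)) (I.point (u' I γ) (v' I γ)) (I.point (v' I γ) (u' I γ))) := by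
  refine DefProp.point hu (P := fun I γ p => ProperCross p (I.point (v I γ) (u I γ))
    (I.point (u' I γ) (v' I γ)) (I.point (v' I γ) (u' I γ))) ?_
  refine DefProp.point (Γ := Γ.ext) hv.weaken (P := fun I γ p => ProperCross
    (I.pointOfSize (I.order.pos γ.2) (u I γ.1) (v I γ.1)) p
    (I.point (u' I γ.1) (v' I γ.1)) (I.point (v' I γ.1) (u' I γ.1))) ?_
  refine DefProp.point (Γ := Γ.ext.ext) hu'.weaken.weaken (P := fun I γ p => ProperCross
    (I.pointOfSize (I.order.pos γ.1.2) (u I γ.1.1) (v I γ.1.1))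
    (I.pointOfSize (I.order.pos γ.2) (v I γ.1.1) (u I γ.1.1)) p
    (I.point (v' I γ.1.1) (u' I γ.1.1))) ?_
  refine DefProp.point (Γ := Γ.ext.ext.ext) hv'.weaken.weaken.weaken
    (P := fun I γ p => ProperCross
      (I.pointOfSize (I.order.pos γ.1.1.2) (u I γ.1.1.1) (v I γ.1.1.1))
      (I.pointOfSize (I.order.pos γ.1.2) (v I γ.1.1.1) (u I γ.1.1.1))
      (I.pointOfSize (I.order.pos γ.2) (u' I γ.1.1.1) (v' I γ.1.1.1)) p) ?_
  have hu := hu.weaken.weaken.weaken.weaken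
  have hv := hv.weaken.weaken.weaken.weaken
  have hu' := hu'.weaken.weaken.weaken.weaken
  have hv' := hv'.weaken.weaken.weaken.weaken
  exact DefProp.properCross
    (.pointOfSize hu hv (IsVar.last (Γ := Γ)).weaken.weaken.weaken)
    (.pointOfSize hv hu (IsVar.last (Γ := Γ.ext)).weaken.weaken)
    (.pointOfSize hu' hv' (IsVar.last (Γ := Γ.ext.ext)).weaken)
    (.pointOfSize hv' hu' (IsVar.last (Γ := Γ.ext.ext.ext)))

theorem DefReal.gap (i : Fin 4) : DefReal Γ (fun I γ =>
    (I.square (I.G.cluster (u I γ))).gap i (I.square (I.G.cluster (v I γ)))) := by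
  have hx := DefReal.square_x hu
  have hy := DefReal.square_y hu
  have hl := DefReal.square_len hu
  have hx' := DefReal.square_x hv
  have hy' := DefReal.square_y hv
  have hl' := DefReal.square_len hv
  match i with
  | 0 => exact (hx.add hl).sub hx'
  | 1 => exact (hx'.add hl').sub hx
  | 2 => exact (hy.add hl).sub hy'
  | 3 => exact (hy'.add hl').sub hy

theorem DefProp.apart : DefProp Γ (fun I γ =>
    (I.square (I.G.cluster (u I γ))).Apart (I.square (I.G.cluster (v I γ)))) := by
  have hx := DefReal.square_x hu
  have hy := DefReal.square_y hu
  have hl := DefReal.square_len hu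
  have hx' := DefReal.square_x hv
  have hy' := DefReal.square_y hv
  have hl' := DefReal.square_len hv
  exact ((DefProp.lt (hx.add hl) hx').or (.lt (hx'.add hl') hx)).or
    ((DefProp.lt (hy.add hl) hy').or (.lt (hy'.add hl') hy))

theorem DefProp.meetsPipe (hw : IsVar Γ w) : DefProp Γ (fun I γ =>
    (I.square (I.G.cluster (w I γ))).MeetsPipe (I.square (I.G.cluster (u I γ)))
      (I.square (I.G.cluster (v I γ)))) :=
  (DefProp.forall_fin fun i => (DefProp.le .zero (.gap hw hu i)).or (.le .zero (.gap hw hv i))).and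
    (DefProp.forall_fin fun i => DefProp.forall_fin fun j =>
      (DefProp.lt (.gap hw hu i) .zero).imp ((DefProp.lt (.gap hw hv j) .zero).imp
        (.le ((DefReal.gap hw hu i).mul (.gap hw hv j))
          ((DefReal.gap hw hv i).mul (.gap hw hu j)))))

end Vertices

end Definability

theorem defProp_straight : DefProp .empty (fun I _ => I.Straight) := by
  -- Variables are counted from the innermost quantifier, starting with `0`.
  have h0 : ∀ {Γ : Ctx}, IsVar Γ.ext (fun _ γ => γ.2) := IsVar.last
  have h1 : ∀ {Γ : Ctx}, IsVar Γ.ext.ext (fun _ γ => γ.1.2) := IsVar.last.weaken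
  have h2 : ∀ {Γ : Ctx}, IsVar Γ.ext.ext.ext (fun _ γ => γ.1.1.2) := IsVar.last.weaken.weaken
  have h3 : ∀ {Γ : Ctx}, IsVar Γ.ext.ext.ext.ext (fun _ γ => γ.1.1.1.2) :=
    IsVar.last.weaken.weaken.weaken
  have ha := DefProp.all (Γ := Ctx.empty)
    (P := fun I _ u => ∀ v, I.G.cluster u ≠ I.G.cluster v →
      (I.square (I.G.cluster u)).Apart (I.square (I.G.cluster v)))
    (DefProp.all (Γ := Ctx.empty.ext)
      (P := fun I γ v => I.G.cluster γ.2 ≠ I.G.cluster v →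
        (I.square (I.G.cluster γ.2)).Apart (I.square (I.G.cluster v)))
      ((DefProp.sameCluster h1 h0).not.imp (.apart h1 h0)))
  have hb := DefProp.all (Γ := Ctx.empty)
    (P := fun I _ u => ∀ v, I.G.Inter u v → ∀ w, I.G.cluster w ≠ I.G.cluster u →
      I.G.cluster w ≠ I.G.cluster v → ¬ (I.square (I.G.cluster w)).MeetsPipe
        (I.square (I.G.cluster u)) (I.square (I.G.cluster v)))
    (DefProp.all (Γ := Ctx.empty.ext)
      (P := fun I γ v => I.G.Inter γ.2 v → ∀ w, I.G.cluster w ≠ I.G.cluster γ.2 →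
        I.G.cluster w ≠ I.G.cluster v → ¬ (I.square (I.G.cluster w)).MeetsPipe
          (I.square (I.G.cluster γ.2)) (I.square (I.G.cluster v)))
      ((DefProp.inter h1 h0).imp (DefProp.all (Γ := Ctx.empty.ext.ext)
        (P := fun I γ w => I.G.cluster w ≠ I.G.cluster γ.1.2 → I.G.cluster w ≠ I.G.cluster γ.2 →
          ¬ (I.square (I.G.cluster w)).MeetsPipe (I.square (I.G.cluster γ.1.2))
            (I.square (I.G.cluster γ.2)))
        ((DefProp.sameCluster h0 h2).not.imp ((DefProp.sameCluster h0 h1).not.imp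
          (DefProp.meetsPipe h2 h1 h0).not)))))
  have hc := DefProp.all (Γ := Ctx.empty)
    (P := fun I _ u => ∀ v, I.G.Inter u v →
      0 < (I.side u v).outset (I.point u v) (I.point v u))
    (DefProp.all (Γ := Ctx.empty.ext)
      (P := fun I γ v => I.G.Inter γ.2 v →
        0 < (I.side γ.2 v).outset (I.point γ.2 v) (I.point v γ.2))
      ((DefProp.inter h1 h0).imp (.outward h1 h0)))
  have hd := DefProp.all (Γ := Ctx.empty)
    (P := fun I _ u => ∀ v u' v', I.G.Inter u v → I.G.Inter u' v' →
      I.G.cluster u = I.G.cluster u' → ¬ ProperCross (I.point u v)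
        (I.point v u) (I.point u' v') (I.point v' u'))
    (DefProp.all (Γ := Ctx.empty.ext)
      (P := fun I γ v => ∀ u' v', I.G.Inter γ.2 v → I.G.Inter u' v' →
        I.G.cluster γ.2 = I.G.cluster u' → ¬ ProperCross (I.point γ.2 v)
          (I.point v γ.2) (I.point u' v') (I.point v' u'))
      (DefProp.all (Γ := Ctx.empty.ext.ext)
        (P := fun I γ u' => ∀ v', I.G.Inter γ.1.2 γ.2 → I.G.Inter u' v' →
          I.G.cluster γ.1.2 = I.G.cluster u' → ¬ ProperCross (I.point γ.1.2 γ.2)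
            (I.point γ.2 γ.1.2) (I.point u' v') (I.point v' u'))
        (DefProp.all (Γ := Ctx.empty.ext.ext.ext)
          (P := fun I γ v' => I.G.Inter γ.1.1.2 γ.1.2 → I.G.Inter γ.2 v' →
            I.G.cluster γ.1.1.2 = I.G.cluster γ.2 → ¬ ProperCross (I.point γ.1.1.2 γ.1.2)
              (I.point γ.1.2 γ.1.1.2) (I.point γ.2 v') (I.point v' γ.2))
          ((DefProp.inter h3 h2).imp ((DefProp.inter h1 h0).imp ((DefProp.sameCluster h3 h1).imp
            (DefProp.properCross_point h3 h2 h1 h0).not))))))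
  exact ((ha.and hb).and (hc.and hd)).congr fun I γ =>
    ⟨fun h => ⟨h.1.1, h.1.2, h.2.1, h.2.2⟩, fun h => ⟨⟨h.1, h.2⟩, h.3, h.4⟩⟩

/-! ### Size bounds for the initial memory. -/

theorem bits_le_inputSize {l : List ℤ} {z : ℤ} (h : z ∈ l) : RAM.bits z ≤ RAM.inputSize l :=
  List.single_le_sum (fun _ _ => Nat.zero_le _) _ (List.mem_map_of_mem h)

theorem length_le_inputSize (l : List ℤ) : l.length ≤ RAM.inputSize l := by
  have := List.length_le_sum_of_one_le (l.map RAM.bits) fun i hi => by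
    obtain ⟨z, _, rfl⟩ := List.mem_map.1 hi
    exact RAM.bits_pos z
  simpa [RAM.inputSize] using this

theorem Instance.le_length_encode (I : Instance) : 2 + I.n ≤ I.encode.length := by
  simp only [encode, List.length_append, I.length_vertices, List.length_cons, List.length_nil]
  omega

theorem Instance.bits_memory_le (I : Instance) (a : ℤ) :
    RAM.bits (I.memory a) ≤ RAM.inputSize I.encode := by
  have h0 : RAM.bits 0 ≤ RAM.inputSize I.encode := by
    have := I.le_length_encode
    have := length_le_inputSize I.encode
    rw [RAM.bits_zero]
    omega
  rcases lt_or_ge a 0 with ha | ha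
  · have : I.memory a = 0 := by simp [memory, RAM.init, ha.not_ge]
    rwa [this]
  · obtain ⟨a, rfl⟩ := Int.eq_ofNat_of_zero_le ha
    rw [I.memory_natCast]
    rcases lt_or_ge a I.encode.length with h | h
    · rw [List.getD_eq_getElem _ _ h]
      exact bits_le_inputSize (List.getElem_mem h)
    · rwa [List.getD_eq_default _ _ h]

end NodeTrix

/-- Monotone NodeTrix Local Planarity with fixed order and fixed side can be solved in polynomial
time. -/
theorem theorem7 :
    RAM.SolvableInPolyTime NodeTrix.Instance.encode NodeTrix.Instance.IsYes := by
  obtain ⟨φ, hφ⟩ := NodeTrix.defProp_straight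
  obtain ⟨T, hT⟩ := φ.exists_exec 0
  refine ⟨φ.compile 0, T, fun I => ?_⟩
  have hlen := I.le_length_encode
  have hsize := NodeTrix.length_le_inputSize I.encode
  have h0 := I.memory_zero
  -- The input size serves as `N`: it bounds the bits of every cell, and also `I.n`, because the
  -- encoding has at least `2 + I.n` cells of at least one bit each.
  obtain ⟨t, ht, hE⟩ := hT (RAM.inputSize I.encode) I.memory (fun _ => 0) 0 (by omega)
    I.bits_memory_le (by omega) (by omega) (fun _ => by rw [RAM.bits_zero]; omega) rfl
    (fun _ _ => rfl) (by simp [RAM.bits_zero])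
  rw [Function.update_eq_self] at hE
  refine ⟨t, _, hE, ht, ?_⟩
  have : φ.Holds I.memory 0 (fun _ => 0) ↔ I.IsYes :=
    (hφ I ()).trans NodeTrix.Instance.isYes_iff_straight.symm
  by_cases h : I.IsYes
  · simpa only [Function.update_self, if_pos h] using RAM.truth_of (this.2 h)
  · simpa only [Function.update_self, if_neg h] using RAM.truth_of_not (mt this.1 h)
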